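/- Let $n\ge 8$ and $m>0$. Let $R_0=(m/2)^{1/(n-2)}$, and let the $n$-dimensional Riemannian Schwarzschild space be $M^n=\{x\in\mathbb R^n : |x|\ge R_0\}$ with the metric $g_{Sch}=\left(1+\frac{m}{2|x|^{n-2}}\right)^{4/(n-2)}\delta$, where $\delta$ is the Euclidean metric. A properly embedded free boundary minimal hypersurface $\Sigma\subset M$ is a closed subset that is a smooth hypersurface with nonempty boundary $\partial\Sigma=\Sigma\cap\partial M$, has zero mean curvature and meets $\partial M=\{|x|=R_0\}$ orthogonally along $\partial\Sigma$. For such $\Sigma$ with unit normal $\xi$ and for $R>R_0$ put $\Sigma(R)=\Sigma\cap\{|x|\le R\}$. For smooth $u$ on $\Sigma(R)$ vanishing on $\Sigma\cap\{|x|=R\}$ let $$Q(u,u)=\int_{\Sigma(R)}\Big(|\nabla_\Sigma u|^2-\big(\mathrm{Ric}(\xi,\xi)+|A_\Sigma|^2\big)u^2\Big)\,dv-\int_{\partial\Sigma}A_{\partial M}(\xi,\xi)\,u^2\,ds ,$$ where $A_{\partial M}$ is the second fundamental form of $\partial M$ with respect to the unit normal pointing into $M$. Let $\mathrm{Ind}_F(\Sigma(R))$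 be the maximal dimension of a linear space of such functions on which $Q$ is negative definite; the Morse index of $\Sigma$ is $\limsup_{R\to\infty}\mathrm{Ind}_F(\Sigma(R))\in\{0,1,\dots,\infty\}$. (1) There is a properly embedded free boundary minimal hypersurface in $(M^n,g_{Sch})$ that is not totally geodesic and has Morse index $0$. (2) More precisely, let $1\le k\le n-3$ and let $$\Gamma=\mathbb S^{k}\Big(\sqrt{\tfrac{k}{n-2}}\Big)\times\mathbb S^{n-2-k}\Big(\sqrt{\tfrac{n-2-k}{n-2}}\Big)\subset\mathbb S^{n-1}\subset\mathbb R^{k+1}\times\mathbb R^{n-1-k}$$ be the Clifford torus. Then $\Gamma$ is a closed embedded minimal hypersurface of $\mathbb S^{n-1}$; its second fundamental form in $\mathbb S^{n-1}$ has constant squared norm $|A_\Gamma|^2=n-2$; and the smallest eigenvalue of its Jacobi operator $J_\Gamma f=-\Delta_\Gamma f-|A_\Gamma|^2f$ is $\lambda_1=-(n-2)$. The cone $\Sigma_\Gamma=\{ty : t>0,\ y\in\Gamma\}\cap\{|x|\ge R_0\}$ is a properly embedded free boundary minimal hypersurface of $(M^n,g_{Sch})$ that is not totally geodesic and has Morse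 index $0$. -/

import Mathlib

open scoped ContDiff
open MeasureTheory

noncomputable section

/-- Euclidean space `ℝⁿ`. -/
abbrev Euc (n : ℕ) : Type := EuclideanSpace ℝ (Fin n)

/-! ### Riemannian metrics on (open subsets of) `ℝⁿ`, in the global chart -/

/-- A field of bilinear forms `g x v w` on `ℝⁿ`. -/
abbrev MetricField (n : ℕ) : Type := Euc n → Euc n → Euc n → ℝ

/-- The `k`-th standard basis vector. -/
def stdVec {n : ℕ} (k : Fin n) : Euc n := EuclideanSpace.single k 1

/-- The trace of a linear endomorphism of `ℝⁿ`. -/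
def coordTrace {n : ℕ} (T : Euc n → Euc n) : ℝ := ∑ k, T (stdVec k) k

/-- The matrix `(g_{ij}(x))`. -/
def gramMatrix {n : ℕ} (g : MetricField n) (x : Euc n) : Matrix (Fin n) (Fin n) ℝ :=
  Matrix.of fun i j => g x (stdVec i) (stdVec j)

/-- The vector representing the linear functional `ℓ` with respect to `g x`:
`g x (raiseIndex g x ℓ) z = ℓ z`. -/
def raiseIndex {n : ℕ} (g : MetricField n) (x : Euc n) (ℓ : Euc n → ℝ) : Euc n :=
  ∑ i, (∑ j, (gramMatrix g x)⁻¹ i j * ℓ (stdVec j)) • stdVec i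

/-- The Christoffel symbols of the Levi-Civita connection of `g`, as the vector `Γ_x(v, w)`. -/
def christoffel {n : ℕ} (g : MetricField n) (x v w : Euc n) : Euc n :=
  raiseIndex g x fun z =>
    (1 / 2 : ℝ) * (fderiv ℝ (fun y => g y w z) x v + fderiv ℝ (fun y => g y v z) x w
      - fderiv ℝ (fun y => g y v w) x z)

/-- The Levi-Civita covariant derivative `∇_v X` at `x`. -/
def covDeriv {n : ℕ} (g : MetricField n) (X : Euc n → Euc n) (x v : Euc n) : Euc n :=
  fderiv ℝ X x v + christoffel g x v (X x)

/-- The curvature tensor `R(u, v) w = ∇_u ∇_v w - ∇_v ∇_u w - ∇_{[u,v]} w` at `x`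
(evaluated on constant vector fields, for which the bracket vanishes). -/
def curvatureTensor {n : ℕ} (g : MetricField n) (x u v w : Euc n) : Euc n :=
  fderiv ℝ (fun y => christoffel g y v w) x u - fderiv ℝ (fun y => christoffel g y u w) x v
    + christoffel g x u (christoffel g x v w) - christoffel g x v (christoffel g x u w)

/-- The Ricci curvature `Ric(v, w) = tr (u ↦ R(u, v) w)`. -/
def ricciCurvature {n : ℕ} (g : MetricField n) (x v w : Euc n) : ℝ :=
  coordTrace fun u => curvatureTensor g x u v w

/-- The gradient of `u` with respect to `g`. -/
def metricGradient {n : ℕ} (g : MetricField n) (u : Euc n → ℝ) (x : Euc n) : Euc n :=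
  raiseIndex g x fun z => fderiv ℝ u x z

/-! ### Hypersurfaces of `ℝⁿ` and their geometry with respect to `g` -/

/-- Near `p`, the set `S` is a smooth hypersurface without boundary, with tangent space `T` at `p`:
it is the zero set of a submersion. -/
def IsInteriorPoint {n : ℕ} (S : Set (Euc n)) (p : Euc n) (T : Set (Euc n)) : Prop :=
  ∃ (U : Set (Euc n)) (φ : Euc n → ℝ), IsOpen U ∧ p ∈ U ∧ ContDiffOn ℝ ∞ φ U ∧ φ p = 0 ∧
    fderiv ℝ φ p ≠ 0 ∧ S ∩ U = {x | x ∈ U ∧ φ x = 0} ∧ T = {v | fderiv ℝ φ p v = 0}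

/-- Near `p`, the set `S` is a smooth hypersurface with boundary, `p` is one of its boundary points,
and `T` is the tangent space at `p`: the set `S` is cut out as `φ = 0`, `ψ ≥ 0`, where `φ` and `ψ`
vanish at `p` and have linearly independent differentials there. -/
def IsBoundaryPoint {n : ℕ} (S : Set (Euc n)) (p : Euc n) (T : Set (Euc n)) : Prop :=
  ∃ (U : Set (Euc n)) (φ ψ : Euc n → ℝ), IsOpen U ∧ p ∈ U ∧ ContDiffOn ℝ ∞ φ U ∧
    ContDiffOn ℝ ∞ ψ U ∧ φ p = 0 ∧ ψ p = 0 ∧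
    LinearIndependent ℝ ![fderiv ℝ φ p, fderiv ℝ ψ p] ∧
    S ∩ U = {x | x ∈ U ∧ φ x = 0 ∧ 0 ≤ ψ x} ∧ T = {v | fderiv ℝ φ p v = 0}

/-- `S` is a properly embedded smooth hypersurface of `{x | R₀ ≤ ‖x‖}`: a closed subset which is a
smooth hypersurface with boundary, such that `∂S` is the intersection of `S` with `{‖x‖ = R₀}`. -/
structure IsProperlyEmbedded {n : ℕ} (R₀ : ℝ) (S : Set (Euc n)) : Prop where
  nonempty : S.Nonempty
  isClosed : IsClosed S
  subset : ∀ p ∈ S, R₀ ≤ ‖p‖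
  interior_point : ∀ p ∈ S, R₀ < ‖p‖ → ∃ T, IsInteriorPoint S p T
  boundary_point : ∀ p ∈ S, ‖p‖ = R₀ → ∃ T, IsBoundaryPoint S p T

/-- `ξ` is (a smooth extension to a neighbourhood of `S` of) a unit normal field along `S`. -/
structure IsUnitNormal {n : ℕ} (g : MetricField n) (S : Set (Euc n)) (ξ : Euc n → Euc n) :
    Prop where
  smooth : ∃ U : Set (Euc n), IsOpen U ∧ S ⊆ U ∧ ContDiffOn ℝ ∞ ξ U
  unit : ∀ p ∈ S, g p (ξ p) (ξ p) = 1
  normal : ∀ p ∈ S, ∃ T, (IsInteriorPoint S p T ∨ IsBoundaryPoint S p T) ∧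
    ∀ v ∈ T, g p (ξ p) v = 0

/-- The `g`-orthogonal projection of `ℝⁿ` onto the tangent space `ξ(x)^⊥`. -/
def tanProj {n : ℕ} (g : MetricField n) (ξ : Euc n → Euc n) (x v : Euc n) : Euc n :=
  v - g x (ξ x) v • ξ x

/-- The second fundamental form `A(v, w) = -g(∇_v ξ, w)`, for tangent vectors `v`, `w`. -/
def secondFF {n : ℕ} (g : MetricField n) (ξ : Euc n → Euc n) (x v w : Euc n) : ℝ :=
  -g x (covDeriv g ξ x v) w

/-- The shape operator `v ↦ -∇_v ξ` of the tangent space, extended by zero to the normal line. -/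
def shapeOp {n : ℕ} (g : MetricField n) (ξ : Euc n → Euc n) (x v : Euc n) : Euc n :=
  tanProj g ξ x (-covDeriv g ξ x (tanProj g ξ x v))

/-- The mean curvature, the trace of the shape operator. -/
def meanCurvature {n : ℕ} (g : MetricField n) (ξ : Euc n → Euc n) (x : Euc n) : ℝ :=
  coordTrace (shapeOp g ξ x)

/-- `|A|²`, the squared norm of the second fundamental form: the trace of the square of the
(self-adjoint) shape operator. -/
def normSqA {n : ℕ} (g : MetricField n) (ξ : Euc n → Euc n) (x : Euc n) : ℝ :=
  coordTrace fun v => shapeOp g ξ x (shapeOp g ξ x v)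

/-- `|∇_S u|²`, the squared `g`-norm of the tangential gradient of `u`. -/
def normSqTanGrad {n : ℕ} (g : MetricField n) (ξ : Euc n → Euc n) (u : Euc n → ℝ) (x : Euc n) :
    ℝ :=
  g x (tanProj g ξ x (metricGradient g u x)) (tanProj g ξ x (metricGradient g u x))

/-- The second fundamental form vanishes on all tangent spaces of `S`. -/
def IsTotallyGeodesic {n : ℕ} (g : MetricField n) (S : Set (Euc n)) (ξ : Euc n → Euc n) : Prop :=
  ∀ p ∈ S, ∀ v w, g p (ξ p) v = 0 → g p (ξ p) w = 0 → secondFF g ξ p v w = 0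

/-! ### The Riemannian Schwarzschild space of dimension `n` and mass `m` -/

/-- The radius `R₀ = (m/2)^{1/(n-2)}` of the horizon. -/
def horizonRadius (n : ℕ) (m : ℝ) : ℝ := (m / 2) ^ (1 / ((n : ℝ) - 2))

/-- The conformal factor `f = (1 + m / (2 |x|^{n-2}))^{2/(n-2)}`. -/
def schwFactor (n : ℕ) (m : ℝ) (x : Euc n) : ℝ :=
  (1 + m / (2 * ‖x‖ ^ (n - 2))) ^ (2 / ((n : ℝ) - 2))

/-- The Schwarzschild metric `g = f² δ`, considered on `{x | R₀ ≤ ‖x‖}`. -/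
def schwMetric (n : ℕ) (m : ℝ) : MetricField n :=
  fun x v w => schwFactor n m x ^ 2 * inner ℝ v w

/-- The unit normal of the spheres about the origin which along the horizon points
into `{x | R₀ ≤ ‖x‖}`. -/
def radialNormal (n : ℕ) (m : ℝ) (x : Euc n) : Euc n := (schwFactor n m x * ‖x‖)⁻¹ • x

/-- `S`, with unit normal `ξ`, is a properly embedded free boundary minimal hypersurface of the
Schwarzschild space: it is properly embedded, has zero mean curvature, and meets the horizon
orthogonally along its (nonempty) boundary. -/
structure IsFreeBoundaryMinimal (n : ℕ) (m : ℝ) (S : Set (Euc n)) (ξ : Euc n → Euc n) :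
    Prop where
  properly_embedded : IsProperlyEmbedded (horizonRadius n m) S
  unit_normal : IsUnitNormal (schwMetric n m) S ξ
  minimal : ∀ p ∈ S, meanCurvature (schwMetric n m) ξ p = 0
  boundary_nonempty : ∃ p ∈ S, ‖p‖ = horizonRadius n m
  orthogonal : ∀ p ∈ S, ‖p‖ = horizonRadius n m →
    schwMetric n m p (ξ p) (radialNormal n m p) = 0

/-- The quadratic form of the second variation of area on `S(R) = S ∩ {‖x‖ ≤ R}`, for functions `u`
that vanish on `S ∩ {‖x‖ = R}`:
`Q(u, u) = ∫_{S(R)} (|∇u|² - (Ric(ξ, ξ) + |A|²) u²) dv - ∫_{∂S} A_{∂M}(ξ, ξ) u² ds`.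
Since `g = f² δ`, the Riemannian measure of a `d`-dimensional submanifold is `f ^ d` times its
Euclidean `d`-dimensional area. -/
def indexForm (n : ℕ) (m : ℝ) (S : Set (Euc n)) (ξ : Euc n → Euc n) (R : ℝ) (u : Euc n → ℝ) : ℝ :=
  (∫ x in S ∩ {x | ‖x‖ ≤ R},
      (normSqTanGrad (schwMetric n m) ξ u x
        - (ricciCurvature (schwMetric n m) x (ξ x) (ξ x) + normSqA (schwMetric n m) ξ x) * u x ^ 2)
        * schwFactor n m x ^ (n - 1) ∂(Measure.euclideanHausdorffMeasure (n - 1)))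
  - ∫ x in S ∩ {x | ‖x‖ = horizonRadius n m},
      secondFF (schwMetric n m) (radialNormal n m) x (ξ x) (ξ x) * u x ^ 2
        * schwFactor n m x ^ (n - 2) ∂(Measure.euclideanHausdorffMeasure (n - 2))

/-- `V` is a linear space of smooth functions on `S(R)`, vanishing on `S ∩ {‖x‖ = R}`, on which the
second variation is negative definite. Smooth functions on `S(R)` are the restrictions of smooth
functions on `ℝⁿ`. -/
def IsNegativeSpace (n : ℕ) (m : ℝ) (S : Set (Euc n)) (ξ : Euc n → Euc n) (R : ℝ)
    (V : Submodule ℝ (↥(S ∩ {x | ‖x‖ ≤ R}) → ℝ)) : Prop :=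
  ∀ v ∈ V, v ≠ 0 → ∃ u : Euc n → ℝ, ContDiff ℝ ∞ u ∧ (∀ x, u x.1 = v x) ∧
    (∀ x ∈ S, ‖x‖ = R → u x = 0) ∧ indexForm n m S ξ R u < 0

/-- The Morse index of `S(R)` for functions vanishing on `{‖x‖ = R}`: the maximal dimension of a
space on which the second variation is negative definite. -/
def morseIndexAt (n : ℕ) (m : ℝ) (S : Set (Euc n)) (ξ : Euc n → Euc n) (R : ℝ) : ℕ∞ :=
  ⨆ (V : Submodule ℝ (↥(S ∩ {x | ‖x‖ ≤ R}) → ℝ)) (_ : IsNegativeSpace n m S ξ R V),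
    Cardinal.toENat (Module.rank ℝ V)

/-- The Morse index of `S`. -/
def morseIndex (n : ℕ) (m : ℝ) (S : Set (Euc n)) (ξ : Euc n → Euc n) : ℕ∞ :=
  Filter.limsup (fun R : ℝ => morseIndexAt n m S ξ R) Filter.atTop

/-! ### Closed hypersurfaces of the unit sphere `𝕊^{n-1} ⊆ ℝⁿ` -/

/-- Near `p`, the set `Γ` is a smooth hypersurface of the unit sphere, with tangent space `T`. -/
def IsSpherePoint {n : ℕ} (Γ : Set (Euc n)) (p : Euc n) (T : Set (Euc n)) : Prop :=
  ∃ (U : Set (Euc n)) (φ : Euc n → ℝ), IsOpen U ∧ p ∈ U ∧ ContDiffOn ℝ ∞ φ U ∧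
    (∃ v, inner ℝ p v = 0 ∧ fderiv ℝ φ p v ≠ 0) ∧
    Γ ∩ U = {x | x ∈ U ∧ ‖x‖ = 1 ∧ φ x = 0} ∧ T = {v | inner ℝ p v = 0 ∧ fderiv ℝ φ p v = 0}

/-- `η` is (a smooth extension of) a unit normal field of `Γ` in the unit sphere. -/
structure IsSphereUnitNormal {n : ℕ} (Γ : Set (Euc n)) (η : Euc n → Euc n) : Prop where
  smooth : ∃ U : Set (Euc n), IsOpen U ∧ Γ ⊆ U ∧ ContDiffOn ℝ ∞ η U
  unit : ∀ p ∈ Γ, ‖η p‖ = 1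
  tangent_sphere : ∀ p ∈ Γ, inner ℝ p (η p) = 0
  normal : ∀ p ∈ Γ, ∃ T, IsSpherePoint Γ p T ∧ ∀ v ∈ T, inner ℝ (η p) v = 0

/-- The orthogonal projection of `ℝⁿ` onto the tangent space of `Γ` at `x`, which is the orthogonal
complement of `x` and `η x`. -/
def sphTanProj {n : ℕ} (η : Euc n → Euc n) (x v : Euc n) : Euc n :=
  v - (inner ℝ x v : ℝ) • x - (inner ℝ (η x) v : ℝ) • η x

/-- The shape operator of `Γ` in the unit sphere, extended by zero to the normal space of `Γ`. -/
def sphShapeOp {n : ℕ} (η : Euc n → Euc n) (x v : Euc n) : Euc n :=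
  sphTanProj η x (-fderiv ℝ η x (sphTanProj η x v))

/-- The mean curvature of `Γ` in the unit sphere. -/
def sphMeanCurvature {n : ℕ} (η : Euc n → Euc n) (x : Euc n) : ℝ := coordTrace (sphShapeOp η x)

/-- `|A_Γ|²`, for the second fundamental form of `Γ` in the unit sphere. -/
def sphNormSqA {n : ℕ} (η : Euc n → Euc n) (x : Euc n) : ℝ :=
  coordTrace fun v => sphShapeOp η x (sphShapeOp η x v)

/-- The Laplace-Beltrami operator `Δ_Γ f = div_Γ (∇_Γ f)`. -/
def sphLaplacian {n : ℕ} (η : Euc n → Euc n) (f : Euc n → ℝ) (x : Euc n) : ℝ :=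
  coordTrace fun v =>
    sphTanProj η x (fderiv ℝ (fun y => sphTanProj η y (gradient f y)) x (sphTanProj η x v))

/-- `Γ`, with unit normal `η`, is a closed embedded minimal hypersurface of the unit sphere. -/
structure IsClosedMinimalInSphere {n : ℕ} (Γ : Set (Euc n)) (η : Euc n → Euc n) : Prop where
  nonempty : Γ.Nonempty
  isCompact : IsCompact Γ
  hypersurface : ∀ p ∈ Γ, ∃ T, IsSpherePoint Γ p T
  unit_normal : IsSphereUnitNormal Γ η
  minimal : ∀ p ∈ Γ, sphMeanCurvature η p = 0

/-- `μ` is an eigenvalue of the Jacobi operator `J_Γ f = -Δ_Γ f - |A_Γ|² f`. -/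
def IsJacobiEigenvalue {n : ℕ} (Γ : Set (Euc n)) (η : Euc n → Euc n) (μ : ℝ) : Prop :=
  ∃ f : Euc n → ℝ, ContDiff ℝ ∞ f ∧ (∃ p ∈ Γ, f p ≠ 0) ∧
    ∀ p ∈ Γ, -sphLaplacian η f p - sphNormSqA η p * f p = μ * f p

/-- The Clifford torus `𝕊^k(√(k/(n-2))) × 𝕊^{n-2-k}(√((n-2-k)/(n-2)))` in
`ℝ^{k+1} × ℝ^{n-1-k} = ℝⁿ`. -/
def cliffordTorus (n k : ℕ) : Set (Euc n) :=
  {x | ∑ i : Fin n, (if i.val < k + 1 then x i ^ 2 else 0) = (k : ℝ) / ((n : ℝ) - 2) ∧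
    ∑ i : Fin n, (if i.val < k + 1 then 0 else x i ^ 2) = ((n : ℝ) - 2 - k) / ((n : ℝ) - 2)}

/-- The truncated cone `Σ_Γ = {t y | t > 0, y ∈ Γ} ∩ {R₀ ≤ ‖x‖}`. -/
def truncatedCone {n : ℕ} (R₀ : ℝ) (Γ : Set (Euc n)) : Set (Euc n) :=
  {x | R₀ ≤ ‖x‖ ∧ ∃ t : ℝ, 0 < t ∧ ∃ y ∈ Γ, x = t • y}

end

/-! The Clifford torus is the unit link of the quadratic cone `⟪x, D x⟫ = 0`, where `D` is diagonal
with eigenvalues `α` and `-α⁻¹`, and `α` is the ratio of the radii of the two factors. The identity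
`D² = (α - α⁻¹) D + 1` gives `‖D x‖ = ‖x‖` on the cone, so `D x` is a unit normal of the link, and
its shape operator is `-D` on tangent vectors. `D` preserves the plane spanned by `x` and `D x` and
has the same trace there as on the whole space. Hence its tangential trace vanishes (minimality) and
its square has tangential trace `n - 2`. These facts pass to the cone by rescaling, since the
Schwarzschild metric is conformal with a radial factor `f` and the normal of the cone is orthogonal
to the radial direction.

The constant function realizes the Jacobi eigenvalue `-(n - 2)`. It is least by a maximum principle:
at a maximum, second derivatives along explicit circles inside the link, averaged over the two
eigenspaces of `D`, give `Δ f ≤ 0` (`sphLaplacian_nonpos_of_isMaxOn`).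

For the index, let `τ` be the logarithmic derivative of `r f`. Then `Ric(ξ, ξ) + |A|² = (n - 2) (3 -
τ²) / (2 f² r²)`. The horizon is totally geodesic, so the boundary term of `Q` vanishes. Discarding
the part of the gradient orthogonal to the ray leaves a one-dimensional inequality on each ray.
`ray_stability` proves it by subtracting the exact derivative of `-3 τ (f t)^(n-3) φ²`: the
remainder is a square plus `(2 n - 16) τ² φ²`, up to a positive weight, which is where `n ≥ 8`
enters. The boundary values of the exact term vanish because `τ = 0` on the horizon and `φ = 0` at
the outer end.

The ray inequalities are assembled by `integral_nonneg_of_forall_ray`, which replaces polar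
coordinates on the cone by averaging over dilations. It needs finite area of cone annuli, obtained
from local graph parametrizations. Thus `Q ≥ 0` on every truncation, and no nonzero negative space
exists. -/

/-! ### Radial profiles of the Schwarzschild metric -/

noncomputable section

/-- The conformal factor of the Schwarzschild metric as a function of the radius. -/
def schwProfile (n : ℕ) (m r : ℝ) : ℝ := (1 + m / (2 * r ^ (n - 2))) ^ (2 / ((n : ℝ) - 2))

/-- The logarithmic derivative of `r * schwProfile n m r` with respect to `log r`. -/
def schwTau (n : ℕ) (m r : ℝ) : ℝ := (2 * r ^ (n - 2) - m) / (2 * r ^ (n - 2) + m)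

/-- The coefficient of the Christoffel symbols of the Schwarzschild metric. -/
def schwCoeff (n : ℕ) (m r : ℝ) : ℝ := (schwTau n m r - 1) / r ^ 2

end

lemma schwFactor_eq_profile (n : ℕ) (m : ℝ) (x : Euc n) :
    schwFactor n m x = schwProfile n m ‖x‖ := rfl

lemma schwProfile_pos {n : ℕ} {m r : ℝ} (hm : 0 < m) (hr : 0 < r) : 0 < schwProfile n m r := by
  unfold schwProfile; positivity

lemma hasDerivAt_pow_sub_two {n : ℕ} (hn : 2 < n) {r : ℝ} (hr : 0 < r) :
    HasDerivAt (fun s : ℝ => s ^ (n - 2)) (((n : ℝ) - 2) * r ^ (n - 2) / r) r := by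
  obtain ⟨k, rfl⟩ : ∃ k, n = k + 3 := ⟨n - 3, by omega⟩
  have h1 : k + 3 - 2 = k + 1 := by omega
  rw [h1]
  refine (hasDerivAt_pow (k + 1) r).congr_deriv ?_
  rw [Nat.add_sub_cancel]
  push_cast
  field_simp
  ring

lemma hasDerivAt_schwProfile {n : ℕ} (hn : 2 < n) {m r : ℝ} (hm : 0 < m) (hr : 0 < r) :
    HasDerivAt (schwProfile n m) (schwProfile n m r * (schwTau n m r - 1) / r) r := by
  have hP := hasDerivAt_pow_sub_two hn hr
  have hp : 0 < r ^ (n - 2) := by positivity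
  have hn' : (0 : ℝ) < (n : ℝ) - 2 := by
    have : (2 : ℝ) < n := by exact_mod_cast hn
    linarith
  have h1 : HasDerivAt (fun s : ℝ => 1 + m / (2 * s ^ (n - 2)))
      (-(((n : ℝ) - 2) * m / (2 * r ^ (n - 2)) / r)) r := by
    have := (((hP.const_mul 2).fun_inv (by positivity)).const_mul m).const_add 1
    simp only [← div_eq_mul_inv] at this
    refine this.congr_deriv ?_
    field_simp
  have h2 := h1.rpow_const (p := 2 / ((n : ℝ) - 2)) (Or.inl (by positivity))
  refine h2.congr_deriv ?_
  unfold schwProfile schwTau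
  have hpos : 0 < 1 + m / (2 * r ^ (n - 2)) := by positivity
  rw [Real.rpow_sub_one hpos.ne']
  generalize (1 + m / (2 * r ^ (n - 2))) ^ (2 / ((n : ℝ) - 2)) = F
  field_simp
  ring

/-- This closed equation for `τ`, together with `r f' = f (τ - 1)`, keeps all later curvature
computations polynomial in `τ`, with no reference to the explicit conformal factor. -/
lemma hasDerivAt_schwTau {n : ℕ} (hn : 2 < n) {m r : ℝ} (hm : 0 < m) (hr : 0 < r) :
    HasDerivAt (schwTau n m) (((n : ℝ) - 2) / 2 * (1 - schwTau n m r ^ 2) / r) r := by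
  have hP := hasDerivAt_pow_sub_two hn hr
  have hp : 0 < r ^ (n - 2) := by positivity
  have := ((hP.const_mul 2).sub_const m).fun_div ((hP.const_mul 2).add_const m) (by positivity)
  refine this.congr_deriv ?_
  unfold schwTau
  field_simp
  ring

lemma hasDerivAt_schwCoeff {n : ℕ} (hn : 2 < n) {m r : ℝ} (hm : 0 < m) (hr : 0 < r) :
    HasDerivAt (schwCoeff n m)
      ((((n : ℝ) - 2) / 2 * (1 - schwTau n m r ^ 2) - 2 * (schwTau n m r - 1)) / r ^ 3) r := by
  have := ((hasDerivAt_schwTau hn hm hr).sub_const 1).fun_div (hasDerivAt_pow 2 r) (by positivity)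
  refine this.congr_deriv ?_
  field_simp
  ring

lemma horizonRadius_pos (n : ℕ) {m : ℝ} (hm : 0 < m) : 0 < horizonRadius n m := by
  unfold horizonRadius; positivity

/-- The horizon is a critical radius of `r f`. This is used twice: to make the horizon totally
geodesic and to remove the inner boundary value in `ray_stability`. -/
lemma schwTau_horizonRadius {n : ℕ} (hn : 2 < n) {m : ℝ} (hm : 0 < m) :
    schwTau n m (horizonRadius n m) = 0 := by
  have hn' : ((n - 2 : ℕ) : ℝ) = (n : ℝ) - 2 := by
    rw [Nat.cast_sub hn.le]; norm_num
  have h0 : (n : ℝ) - 2 ≠ 0 := by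
    have : (2 : ℝ) < n := by exact_mod_cast hn
    linarith
  have : horizonRadius n m ^ (n - 2) = m / 2 := by
    unfold horizonRadius
    rw [← Real.rpow_natCast, ← Real.rpow_mul (by positivity), hn', one_div, inv_mul_cancel₀ h0,
      Real.rpow_one]
  unfold schwTau
  rw [this, mul_div_cancel₀ m two_ne_zero, sub_self, zero_div]

/-! ### Radial functions on a Euclidean space -/

lemma hasFDerivAt_radial {E : Type*} [NormedAddCommGroup E] [InnerProductSpace ℝ E] {F : ℝ → ℝ}
    {F' : ℝ} {x : E} (hx : x ≠ 0) (hF : HasDerivAt F F' ‖x‖) :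
    HasFDerivAt (fun y : E => F ‖y‖) ((F' / ‖x‖) • innerSL ℝ x) x := by
  have hx' : ‖x‖ ≠ 0 := norm_ne_zero_iff.mpr hx
  have h1 : HasFDerivAt (fun y : E => ‖y‖) ((1 / ‖x‖) • innerSL ℝ x) x := by
    have h2 := (hasStrictFDerivAt_norm_sq x).hasFDerivAt.sqrt (by positivity)
    have h3 : (fun y : E => √(‖y‖ ^ 2)) = fun y => ‖y‖ := by
      ext y; exact Real.sqrt_sq (norm_nonneg y)
    rw [h3, Real.sqrt_sq (norm_nonneg x)] at h2
    refine h2.congr_fderiv ?_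
    ext v
    simp
    field_simp
  have h2 := hF.comp_hasFDerivAt x h1
  refine h2.congr_fderiv ?_
  ext v
  simp
  ring

/-! ### Traces -/

section Trace

variable {n : ℕ}

lemma coordTrace_eq_trace (T : Euc n →ₗ[ℝ] Euc n) :
    coordTrace (fun v => T v) = LinearMap.trace ℝ (Euc n) T := by
  rw [LinearMap.trace_eq_sum_inner T (EuclideanSpace.basisFun (Fin n) ℝ)]
  simp [coordTrace, stdVec, EuclideanSpace.inner_single_left]

lemma coordTrace_add (S T : Euc n → Euc n) :
    coordTrace (fun v => S v + T v) = coordTrace S + coordTrace T := by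
  simp [coordTrace, Finset.sum_add_distrib]

lemma coordTrace_sub (S T : Euc n → Euc n) :
    coordTrace (fun v => S v - T v) = coordTrace S - coordTrace T := by
  simp [coordTrace, Finset.sum_sub_distrib]

lemma coordTrace_neg (T : Euc n → Euc n) :
    coordTrace (fun v => -T v) = -coordTrace T := by
  simp [coordTrace]

lemma coordTrace_smul (c : ℝ) (T : Euc n → Euc n) :
    coordTrace (fun v => c • T v) = c * coordTrace T := by
  simp [coordTrace, Finset.mul_sum]

lemma coordTrace_id : coordTrace (fun v : Euc n => v) = n := by
  simp [coordTrace, stdVec]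

lemma coordTrace_smul_id (c : ℝ) : coordTrace (fun v : Euc n => c • v) = c * n := by
  rw [coordTrace_smul c fun v => v, coordTrace_id]

lemma coordTrace_rankOne (a b : Euc n) :
    coordTrace (fun v => (inner ℝ a v : ℝ) • b) = inner ℝ a b := by
  simp [coordTrace, stdVec, PiLp.inner_apply, mul_comm]

end Trace

/-! ### The Levi-Civita connection and the Ricci curvature of the Schwarzschild metric -/

section Connection

variable {n : ℕ} {m : ℝ}

lemma raiseIndex_schwMetric (hm : 0 < m) {x : Euc n} (hx : x ≠ 0) (a : Euc n) :
    raiseIndex (schwMetric n m) x (fun z => inner ℝ a z) = (schwFactor n m x ^ 2)⁻¹ • a := by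
  have hf : 0 < schwFactor n m x := schwProfile_pos hm (norm_pos_iff.mpr hx)
  have hg : gramMatrix (schwMetric n m) x =
      (schwFactor n m x ^ 2) • (1 : Matrix (Fin n) (Fin n) ℝ) := by
    ext i j
    simp [gramMatrix, schwMetric, stdVec, Matrix.one_apply, EuclideanSpace.inner_single_left]
  have hinv : (gramMatrix (schwMetric n m) x)⁻¹ =
      (schwFactor n m x ^ 2)⁻¹ • (1 : Matrix (Fin n) (Fin n) ℝ) := by
    apply Matrix.inv_eq_right_inv
    rw [hg, smul_mul_smul_comm, mul_one, mul_inv_cancel₀ (by positivity), one_smul]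
  ext i
  rw [raiseIndex, hinv]
  simp [stdVec, Matrix.one_apply, EuclideanSpace.inner_single_right, Pi.single_apply]

lemma hasFDerivAt_schwFactor (hn : 2 < n) (hm : 0 < m) {x : Euc n} (hx : x ≠ 0) :
    HasFDerivAt (schwFactor n m)
      ((schwFactor n m x * schwCoeff n m ‖x‖) • innerSL ℝ x) x := by
  have hr := norm_pos_iff.mpr hx
  refine (hasFDerivAt_radial hx (hasDerivAt_schwProfile hn hm hr)).congr_fderiv ?_
  rw [schwFactor_eq_profile, schwCoeff]
  congr 1
  field_simp

lemma fderiv_schwMetric (hn : 2 < n) (hm : 0 < m) {x : Euc n} (hx : x ≠ 0) (v w u : Euc n) :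
    fderiv ℝ (fun y => schwMetric n m y v w) x u =
      2 * schwFactor n m x ^ 2 * schwCoeff n m ‖x‖ * inner ℝ x u * inner ℝ v w := by
  have := ((hasFDerivAt_schwFactor hn hm hx).pow 2).mul_const (inner ℝ v w : ℝ)
  unfold schwMetric
  rw [this.fderiv]
  simp
  ring

lemma christoffel_schwMetric (hn : 2 < n) (hm : 0 < m) {x : Euc n} (hx : x ≠ 0) (v w : Euc n) :
    christoffel (schwMetric n m) x v w =
      schwCoeff n m ‖x‖ • ((inner ℝ x v : ℝ) • w + (inner ℝ x w : ℝ) • v -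
        (inner ℝ v w : ℝ) • x) := by
  have hf : 0 < schwFactor n m x := schwProfile_pos hm (norm_pos_iff.mpr hx)
  have : (fun z => (1 / 2 : ℝ) * (fderiv ℝ (fun y => schwMetric n m y w z) x v
      + fderiv ℝ (fun y => schwMetric n m y v z) x w
      - fderiv ℝ (fun y => schwMetric n m y v w) x z)) = fun z => inner ℝ
        ((schwFactor n m x ^ 2) • (schwCoeff n m ‖x‖ • ((inner ℝ x v : ℝ) • w +
          (inner ℝ x w : ℝ) • v - (inner ℝ v w : ℝ) • x))) z := by
    ext z
    simp only [fderiv_schwMetric hn hm hx, inner_smul_left, inner_add_left, inner_sub_left]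
    simp
    ring
  rw [christoffel, this, raiseIndex_schwMetric hm hx, smul_smul, inv_mul_cancel₀ (by positivity),
    one_smul]

lemma hasFDerivAt_schwCoeff (hn : 2 < n) (hm : 0 < m) {x : Euc n} (hx : x ≠ 0) :
    HasFDerivAt (fun y : Euc n => schwCoeff n m ‖y‖)
      (((((n : ℝ) - 2) / 2 * (1 - schwTau n m ‖x‖ ^ 2) - 2 * (schwTau n m ‖x‖ - 1)) / ‖x‖ ^ 4) •
        innerSL ℝ x) x := by
  have hr := norm_pos_iff.mpr hx
  refine (hasFDerivAt_radial hx (hasDerivAt_schwCoeff hn hm hr)).congr_fderiv ?_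
  congr 1
  field_simp

lemma fderiv_christoffel_schwMetric (hn : 2 < n) (hm : 0 < m) {x : Euc n} (hx : x ≠ 0)
    (v w u : Euc n) :
    fderiv ℝ (fun y => christoffel (schwMetric n m) y v w) x u =
      (((((n : ℝ) - 2) / 2 * (1 - schwTau n m ‖x‖ ^ 2) - 2 * (schwTau n m ‖x‖ - 1)) / ‖x‖ ^ 4) *
        inner ℝ x u) • ((inner ℝ x v : ℝ) • w + (inner ℝ x w : ℝ) • v - (inner ℝ v w : ℝ) • x) +
      schwCoeff n m ‖x‖ • ((inner ℝ u v : ℝ) • w + (inner ℝ u w : ℝ) • v -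
        (inner ℝ v w : ℝ) • u) := by
  have hev : (fun y => christoffel (schwMetric n m) y v w) =ᶠ[nhds x] fun y =>
      schwCoeff n m ‖y‖ • ((inner ℝ v y : ℝ) • w + (inner ℝ w y : ℝ) • v -
        (inner ℝ v w : ℝ) • y) := by
    filter_upwards [isOpen_ne.mem_nhds hx] with y hy
    rw [christoffel_schwMetric hn hm hy, real_inner_comm v, real_inner_comm w]
  rw [hev.fderiv_eq]
  have h1 : HasFDerivAt (fun y : Euc n => (inner ℝ v y : ℝ) • w + (inner ℝ w y : ℝ) • v -
      (inner ℝ v w : ℝ) • y) ((innerSL ℝ v).smulRight w + (innerSL ℝ w).smulRight v -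
        (inner ℝ v w : ℝ) • ContinuousLinearMap.id ℝ (Euc n)) x :=
    (((innerSL ℝ v).hasFDerivAt.smul_const w).add ((innerSL ℝ w).hasFDerivAt.smul_const v)).sub
      ((hasFDerivAt_id x).fun_const_smul _)
  rw [((hasFDerivAt_schwCoeff hn hm hx).fun_smul h1).fderiv, ← real_inner_comm v x,
    ← real_inner_comm w x, real_inner_comm v u, real_inner_comm w u]
  simp only [add_apply, sub_apply, smul_apply, ContinuousLinearMap.smulRight_apply,
    innerSL_apply_apply, ContinuousLinearMap.id_apply, smul_eq_mul]
  module

/-- Only directions orthogonal to `x` are needed, because the normal of the cone is such a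
direction. Under this restriction the curvature operator is a combination of the identity and two
rank-one maps, whose traces are immediate. -/
lemma ricciCurvature_schwMetric (hn : 2 < n) (hm : 0 < m) {x : Euc n} (hx : x ≠ 0) {v : Euc n}
    (hv : inner ℝ x v = (0 : ℝ)) :
    ricciCurvature (schwMetric n m) x v v =
      ((n : ℝ) - 2) / 2 * (1 - schwTau n m ‖x‖ ^ 2) / ‖x‖ ^ 2 * ‖v‖ ^ 2 := by
  set c := schwCoeff n m ‖x‖ with hc
  set c₁ := (((n : ℝ) - 2) / 2 * (1 - schwTau n m ‖x‖ ^ 2) - 2 * (schwTau n m ‖x‖ - 1)) / ‖x‖ ^ 4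
    with hc₁
  have hvx : inner ℝ v x = (0 : ℝ) := by rw [real_inner_comm, hv]
  have key : ∀ u, curvatureTensor (schwMetric n m) x u v v =
      (-(c₁ * ‖v‖ ^ 2) + c ^ 2 * ‖v‖ ^ 2) • ((inner ℝ x u : ℝ) • x) +
      (2 * c + c ^ 2 * ‖x‖ ^ 2) • ((inner ℝ v u : ℝ) • v) -
      (2 * c * ‖v‖ ^ 2 + c ^ 2 * ‖v‖ ^ 2 * ‖x‖ ^ 2) • u := by
    intro u
    unfold curvatureTensor
    rw [fderiv_christoffel_schwMetric hn hm hx, fderiv_christoffel_schwMetric hn hm hx]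
    simp only [christoffel_schwMetric hn hm hx, ← hc, ← hc₁, hv, hvx, inner_smul_right,
      inner_sub_right, inner_add_right, real_inner_self_eq_norm_sq, real_inner_comm v u,
      real_inner_comm x u]
    module
  have : (fun u => curvatureTensor (schwMetric n m) x u v v) = _ := funext key
  rw [ricciCurvature, this, coordTrace_sub, coordTrace_add]
  simp only [coordTrace_smul_id, coordTrace_smul, coordTrace_rankOne, real_inner_self_eq_norm_sq]
  have hr := norm_pos_iff.mpr hx
  rw [hc₁, hc, schwCoeff]
  field_simp
  ring

end Connection

/-! ### Symmetric operators with two eigenvalues of product `-1` -/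

/-- `D` is symmetric with eigenvalues `α > 0` and `-α⁻¹`, and its trace is `α - α⁻¹`. The cone
`⟪x, D x⟫ = 0` is then the cone over a Clifford torus. -/
structure IsCliffordOp {n : ℕ} (D : Euc n →L[ℝ] Euc n) (α : ℝ) : Prop where
  pos : 0 < α
  symm : ∀ x y, inner ℝ (D x) y = (inner ℝ x (D y) : ℝ)
  sq : ∀ x, D (D x) = (α - α⁻¹) • D x + x
  trace : coordTrace (fun v => D v) = α - α⁻¹

namespace IsCliffordOp

variable {n : ℕ} {D : Euc n →L[ℝ] Euc n} {α : ℝ}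

/-- This symmetry exchanges the two sphere factors, so a statement about the `α`-eigenspace also
yields the one about the other eigenspace. -/
lemma neg (h : IsCliffordOp D α) : IsCliffordOp (-D) α⁻¹ where
  pos := inv_pos.mpr h.pos
  symm x y := by simp [h.symm]
  sq x := by simp [h.sq]; module
  trace := by simp [coordTrace_neg, h.trace]

lemma inner_map_map (h : IsCliffordOp D α) (x v : Euc n) :
    inner ℝ (D x) (D v) = (α - α⁻¹) * inner ℝ (D x) v + (inner ℝ x v : ℝ) := by
  rw [← h.symm, h.sq, inner_add_left, inner_smul_left]; simp

lemma norm_sq_map (h : IsCliffordOp D α) {x : Euc n} (hx : inner ℝ x (D x) = (0 : ℝ)) :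
    ‖D x‖ ^ 2 = ‖x‖ ^ 2 := by
  rw [← real_inner_self_eq_norm_sq, h.inner_map_map, h.symm, hx, real_inner_self_eq_norm_sq]; simp

lemma norm_map (h : IsCliffordOp D α) {x : Euc n} (hx : inner ℝ x (D x) = (0 : ℝ)) :
    ‖D x‖ = ‖x‖ := by
  have := h.norm_sq_map hx
  exact (sq_eq_sq₀ (norm_nonneg _) (norm_nonneg _)).mp this

lemma hasFDerivAt_quadratic (h : IsCliffordOp D α) (x : Euc n) :
    HasFDerivAt (fun y => (inner ℝ y (D y) : ℝ)) ((2 : ℝ) • innerSL ℝ (D x)) x := by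
  refine ((hasFDerivAt_id x).inner ℝ D.hasFDerivAt).congr_fderiv ?_
  ext v
  simp [h.symm]
  rw [← h.symm, real_inner_comm]
  ring

lemma fderiv_quadratic (h : IsCliffordOp D α) (x v : Euc n) :
    fderiv ℝ (fun y => (inner ℝ y (D y) : ℝ)) x v = 2 * inner ℝ (D x) v := by
  rw [(h.hasFDerivAt_quadratic x).fderiv]; simp

lemma contDiff_quadratic (D : Euc n →L[ℝ] Euc n) :
    ContDiff ℝ ∞ (fun y => (inner ℝ y (D y) : ℝ)) :=
  contDiff_id.inner ℝ D.contDiff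

end IsCliffordOp

/-- The link `{‖x‖ = 1, ⟪x, D x⟫ = 0}` of the cone defined by `D`. -/
def quadricLink {n : ℕ} (D : Euc n →L[ℝ] Euc n) : Set (Euc n) :=
  {x | ‖x‖ = 1 ∧ inner ℝ x (D x) = (0 : ℝ)}

/-! ### The link as a minimal hypersurface of the sphere -/

namespace IsCliffordOp

variable {n : ℕ} {D : Euc n →L[ℝ] Euc n} {α : ℝ}

lemma sphTanProj_link (x v : Euc n) : sphTanProj (fun y => D y) x v =
    v - (inner ℝ x v : ℝ) • x - (inner ℝ (D x) v : ℝ) • D x := rfl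

lemma inner_sphTanProj_left {x : Euc n} (hx : x ∈ quadricLink D)
    (v : Euc n) : inner ℝ x (sphTanProj (fun y => D y) x v) = (0 : ℝ) := by
  simp [sphTanProj_link, inner_sub_right, inner_smul_right, hx.2, hx.1]

lemma inner_map_sphTanProj (h : IsCliffordOp D α) {x : Euc n} (hx : x ∈ quadricLink D)
    (v : Euc n) : inner ℝ (D x) (sphTanProj (fun y => D y) x v) = (0 : ℝ) := by
  simp [sphTanProj_link, inner_sub_right, inner_smul_right, h.symm, hx.2, hx.1, h.sq,
    inner_add_right]

lemma sphTanProj_eq_self {x v : Euc n} (h1 : inner ℝ x v = (0 : ℝ))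
    (h2 : inner ℝ (D x) v = (0 : ℝ)) : sphTanProj (fun y => D y) x v = v := by
  simp [sphTanProj_link, h1, h2]

lemma sphTanProj_map (h : IsCliffordOp D α) {x v : Euc n}
    (h1 : inner ℝ x v = (0 : ℝ)) (h2 : inner ℝ (D x) v = (0 : ℝ)) :
    sphTanProj (fun y => D y) x (D v) = D v := by
  apply sphTanProj_eq_self
  · rw [← h.symm, h2]
  · rw [h.inner_map_map, h1, h2]; simp

/-- The unit normal is the restriction of a linear map, so its derivative is `D` itself. No second
projection is needed because `D` preserves the tangent space, being symmetric and preserving the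
span of `x` and `D x`. -/
lemma sphShapeOp_link (h : IsCliffordOp D α) {x : Euc n} (hx : x ∈ quadricLink D) (v : Euc n) :
    sphShapeOp (fun y => D y) x v = -D (sphTanProj (fun y => D y) x v) := by
  have h1 := inner_sphTanProj_left hx v
  have h2 := h.inner_map_sphTanProj hx v
  rw [sphShapeOp, D.hasFDerivAt.fderiv, ← map_neg, h.sphTanProj_map] <;>
    simp [h1, h2]

/-- On the plane spanned by `x` and `D x` the diagonal entries of `D` are `0` and `α - α⁻¹`, which
already exhausts the full trace. -/
lemma coordTrace_map_sphTanProj (h : IsCliffordOp D α) {x : Euc n} (hx : x ∈ quadricLink D) :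
    coordTrace (fun v => D (sphTanProj (fun y => D y) x v)) = 0 := by
  simp only [sphTanProj_link, map_sub, map_smul]
  rw [coordTrace_sub, coordTrace_sub, coordTrace_rankOne, coordTrace_rankOne, h.trace, hx.2,
    h.inner_map_map, real_inner_self_eq_norm_sq, h.norm_map hx.2, hx.1, hx.2]
  ring

lemma coordTrace_sphTanProj (h : IsCliffordOp D α) {x : Euc n} (hx : x ∈ quadricLink D) :
    coordTrace (fun v => sphTanProj (fun y => D y) x v) = (n : ℝ) - 2 := by
  simp only [sphTanProj_link]
  rw [coordTrace_sub, coordTrace_sub, coordTrace_rankOne, coordTrace_rankOne, coordTrace_id,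
    real_inner_self_eq_norm_sq, real_inner_self_eq_norm_sq, h.norm_map hx.2, hx.1]
  ring

lemma sphMeanCurvature_link (h : IsCliffordOp D α) {x : Euc n} (hx : x ∈ quadricLink D) :
    sphMeanCurvature (fun y => D y) x = 0 := by
  rw [sphMeanCurvature, funext (h.sphShapeOp_link hx), coordTrace_neg,
    h.coordTrace_map_sphTanProj hx, neg_zero]

lemma sphNormSqA_link (h : IsCliffordOp D α) {x : Euc n} (hx : x ∈ quadricLink D) :
    sphNormSqA (fun y => D y) x = (n : ℝ) - 2 := by
  have key : ∀ v, sphShapeOp (fun y => D y) x (sphShapeOp (fun y => D y) x v) =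
      (α - α⁻¹) • D (sphTanProj (fun y => D y) x v) + sphTanProj (fun y => D y) x v := by
    intro v
    have h1 := inner_sphTanProj_left hx v
    have h2 := h.inner_map_sphTanProj hx v
    rw [h.sphShapeOp_link hx, h.sphShapeOp_link hx, ← map_neg D (sphTanProj _ x v),
      h.sphTanProj_map] <;>
      simp [h1, h2, h.sq]
  rw [sphNormSqA, funext key, coordTrace_add, coordTrace_smul, h.coordTrace_map_sphTanProj hx,
    h.coordTrace_sphTanProj hx]
  ring

lemma isSpherePoint_link (h : IsCliffordOp D α) {x : Euc n} (hx : x ∈ quadricLink D) :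
    IsSpherePoint (quadricLink D) x {v | inner ℝ x v = (0 : ℝ) ∧ inner ℝ (D x) v = (0 : ℝ)} := by
  refine ⟨Set.univ, fun y => inner ℝ y (D y), isOpen_univ, trivial,
    (contDiff_quadratic D).contDiffOn, ⟨D x, hx.2, ?_⟩, ?_, ?_⟩
  · rw [h.fderiv_quadratic, real_inner_self_eq_norm_sq, h.norm_map hx.2, hx.1]; norm_num
  · ext y; simp [quadricLink]
  · ext v; simp [h.fderiv_quadratic]

lemma isCompact_link (D : Euc n →L[ℝ] Euc n) : IsCompact (quadricLink D) := by
  refine Metric.isCompact_of_isClosed_isBounded ?_ ?_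
  · exact (isClosed_eq continuous_norm continuous_const).inter
      (isClosed_eq (contDiff_quadratic D).continuous continuous_const)
  · refine (Metric.isBounded_iff_subset_closedBall 0).mpr ⟨1, fun x hx => ?_⟩
    simp [hx.1]

lemma isClosedMinimalInSphere_link (h : IsCliffordOp D α) (hne : (quadricLink D).Nonempty) :
    IsClosedMinimalInSphere (quadricLink D) (fun y => D y) where
  nonempty := hne
  isCompact := isCompact_link D
  hypersurface p hp := ⟨_, h.isSpherePoint_link hp⟩
  unit_normal :=
    { smooth := ⟨Set.univ, isOpen_univ, Set.subset_univ _, D.contDiff.contDiffOn⟩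
      unit := fun p hp => by rw [h.norm_map hp.2, hp.1]
      tangent_sphere := fun p hp => hp.2
      normal := fun p hp => ⟨_, h.isSpherePoint_link hp, fun v hv => hv.2⟩ }
  minimal p hp := h.sphMeanCurvature_link hp

end IsCliffordOp

/-! ### The maximum principle on the link -/

/-- If `c` were positive, the point would also be a local minimum. Then `g` would be locally
constant and its second derivative zero. -/
lemma second_deriv_nonpos_of_isLocalMax {g g' : ℝ → ℝ} {a c : ℝ}
    (hg : ∀ t, HasDerivAt g (g' t) t) (hg' : HasDerivAt g' c a) (hmax : IsLocalMax g a) :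
    c ≤ 0 := by
  by_contra! hc
  have hd : deriv g = g' := funext fun t => (hg t).deriv
  have hmin : IsLocalMin g a := by
    refine isLocalMin_of_deriv_deriv_pos ?_ hmax.deriv_eq_zero (hg a).continuousAt
    rw [hd, hg'.deriv]; exact hc
  have hconst : g =ᶠ[nhds a] fun _ => g a := by
    filter_upwards [hmax, hmin] with t h1 h2 using le_antisymm h1 h2
  have h0 : g' =ᶠ[nhds a] fun _ => 0 := by
    filter_upwards [hconst.eventuallyEq_nhds] with t ht
    rw [← (hg t).deriv, ht.deriv_eq, deriv_const]
  have := hg'.unique ((hasDerivAt_const a (0 : ℝ)).congr_of_eventuallyEq h0)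
  linarith

lemma differentiable_gradient {n : ℕ} {f : Euc n → ℝ} (hf : ContDiff ℝ ∞ f) :
    Differentiable ℝ (gradient f) := by
  have h1 : ContDiff ℝ 1 (fderiv ℝ f) := hf.fderiv_right (by norm_cast)
  exact (InnerProductSpace.toDual ℝ (Euc n)).symm.toContinuousLinearEquiv.differentiable.comp
    (h1.differentiable (by norm_num))

lemma hasDerivAt_comp_gradient {n : ℕ} {f : Euc n → ℝ} (hf : ContDiff ℝ ∞ f) {γ : ℝ → Euc n}
    {γ' : Euc n} {t : ℝ} (hγ : HasDerivAt γ γ' t) :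
    HasDerivAt (fun s => f (γ s)) (inner ℝ (gradient f (γ t)) γ') t := by
  have h1 : HasGradientAt f (gradient f (γ t)) (γ t) :=
    ((hf.differentiable (by simp)) (γ t)).hasGradientAt
  exact (h1.hasFDerivAt.comp_hasDerivAt t hγ).congr_deriv (by simp)

namespace IsCliffordOp

variable {n : ℕ} {D : Euc n →L[ℝ] Euc n} {α : ℝ}

/-- The orthogonal projection onto the eigenspace of the eigenvalue `α`. -/
noncomputable def posProj (D : Euc n →L[ℝ] Euc n) (α : ℝ) : Euc n →L[ℝ] Euc n :=
  (α + α⁻¹)⁻¹ • (D + α⁻¹ • ContinuousLinearMap.id ℝ (Euc n))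

lemma posProj_apply (D : Euc n →L[ℝ] Euc n) (α : ℝ) (x : Euc n) :
    posProj D α x = (α + α⁻¹)⁻¹ • (D x + α⁻¹ • x) := by
  simp [posProj]

lemma map_posProj (h : IsCliffordOp D α) (x : Euc n) : D (posProj D α x) = α • posProj D α x := by
  have := h.pos
  rw [posProj_apply]
  simp only [map_smul, map_add, h.sq]
  match_scalars
  · field_simp; ring
  · field_simp

lemma posProj_posProj (h : IsCliffordOp D α) (x : Euc n) :
    posProj D α (posProj D α x) = posProj D α x := by
  have := h.pos
  rw [posProj_apply, h.map_posProj, ← add_smul, smul_smul, inv_mul_cancel₀ (by positivity),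
    one_smul]

lemma inner_posProj (h : IsCliffordOp D α) (x y : Euc n) :
    inner ℝ (posProj D α x) y = (inner ℝ x (posProj D α y) : ℝ) := by
  simp only [posProj_apply, inner_smul_left, inner_smul_right, inner_add_left, inner_add_right,
    h.symm]
  simp

lemma posProj_add_posProj_neg (h : IsCliffordOp D α) (x : Euc n) :
    posProj D α x + posProj (-D) α⁻¹ x = x := by
  have := h.pos
  simp only [posProj_apply, neg_apply, inv_inv]
  match_scalars <;> field_simp <;> ring

lemma norm_sq_posProj (h : IsCliffordOp D α) {x : Euc n} (hx : x ∈ quadricLink D) :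
    ‖posProj D α x‖ ^ 2 = (α + α⁻¹)⁻¹ * α⁻¹ := by
  rw [← real_inner_self_eq_norm_sq, h.inner_posProj, h.posProj_posProj, posProj_apply,
    inner_smul_right, inner_add_right, hx.2, inner_smul_right, real_inner_self_eq_norm_sq, hx.1]
  ring

/-- Rotating the `α`-component of `p` towards `v` traces a circle inside the link. The second
derivative of `f` along it is nonpositive at `p`; it consists of the Hessian term and of the
gradient paired with the acceleration, and the latter gives the right-hand side. -/
lemma hessian_le_of_isMaxOn (h : IsCliffordOp D α) {f : Euc n → ℝ} (hf : ContDiff ℝ ∞ f)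
    {p : Euc n} (hp : p ∈ quadricLink D) (hmax : IsMaxOn f (quadricLink D) p) {v : Euc n}
    (hv : D v = α • v) (hpv : inner ℝ p v = (0 : ℝ)) :
    inner ℝ (fderiv ℝ (gradient f) p v) v ≤
      ‖v‖ ^ 2 / ‖posProj D α p‖ ^ 2 * (inner ℝ (gradient f p) (posProj D α p) : ℝ) := by
  have hα := h.pos
  rcases eq_or_ne v 0 with rfl | hv0
  · simp
  set a := posProj D α p with ha
  have hvn : 0 < ‖v‖ := norm_pos_iff.mpr hv0
  have han2 : 0 < ‖a‖ ^ 2 := by rw [ha, h.norm_sq_posProj hp]; positivity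
  have han : 0 < ‖a‖ := by
    rcases (norm_nonneg a).lt_or_eq with h1 | h1
    · exact h1
    · rw [← h1] at han2; norm_num at han2
  set w : Euc n := (‖a‖ / ‖v‖) • v with hw
  have hwn : ‖w‖ = ‖a‖ := by
    rw [hw, norm_smul, norm_div, norm_norm, norm_norm]; field_simp
  have hDw : D w = α • w := by rw [hw, map_smul, hv, smul_comm]
  have hDa : D a = α • a := h.map_posProj p
  set b : Euc n := p - a with hb
  have hDb : D b = -(α⁻¹ • b) := by
    have h1 : b = posProj (-D) α⁻¹ p := by rw [hb, sub_eq_iff_eq_add', h.posProj_add_posProj_neg]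
    have h2 := h.neg.map_posProj p
    rw [← h1] at h2
    rw [← h2]; simp
  have orth : ∀ y z : Euc n, D y = α • y → D z = -(α⁻¹ • z) → inner ℝ y z = (0 : ℝ) := by
    intro y z hy hz
    have h1 := h.symm y z
    rw [hy, hz, inner_smul_left, inner_neg_right, inner_smul_right] at h1
    simp only [conj_trivial] at h1
    have h2 : (α + α⁻¹) * inner ℝ y z = 0 := by linarith
    exact (mul_eq_zero.mp h2).resolve_left (by positivity)
  have hab := orth a b hDa hDb
  have hwb := orth w b hDw hDb
  have hpab : p = a + b := by rw [hb]; abel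
  have haw : inner ℝ a w = (0 : ℝ) := by
    have h1 : inner ℝ p w = (0 : ℝ) := by rw [hw, inner_smul_right, hpv, mul_zero]
    rw [hpab, inner_add_left, real_inner_comm w b, hwb, add_zero] at h1
    exact h1
  -- The circle in the sphere factor of the `α`-eigenspace, with the other component `b` frozen.
  -- Since `w` has the length of `a` and is orthogonal to it, both quadratic equations of the link
  -- are preserved.
  set γ : ℝ → Euc n := fun t => Real.cos t • a + Real.sin t • w + b with hγ
  have hγ0 : γ 0 = p := by simp [hγ, hpab]
  have hγn : ∀ t, ‖γ t‖ ^ 2 = ‖a‖ ^ 2 + ‖b‖ ^ 2 := by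
    intro t
    rw [← real_inner_self_eq_norm_sq]
    simp only [hγ, inner_add_left, inner_add_right, inner_smul_left, inner_smul_right,
      real_inner_self_eq_norm_sq, hwn, hab, hwb, haw, real_inner_comm a w, real_inner_comm a b,
      real_inner_comm w b]
    simp
    linear_combination ‖a‖ ^ 2 * Real.sin_sq_add_cos_sq t
  have hγD : ∀ t, inner ℝ (γ t) (D (γ t)) = α * ‖a‖ ^ 2 - α⁻¹ * ‖b‖ ^ 2 := by
    intro t
    simp only [hγ, map_add, map_smul, hDa, hDw, hDb, inner_add_left, inner_add_right,
      inner_smul_left, inner_smul_right, inner_neg_right,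
      real_inner_self_eq_norm_sq, hwn, hab, hwb, haw, real_inner_comm a w, real_inner_comm a b,
      real_inner_comm w b]
    simp
    linear_combination α * ‖a‖ ^ 2 * Real.sin_sq_add_cos_sq t
  have hmem : ∀ t, γ t ∈ quadricLink D := by
    intro t
    refine ⟨?_, ?_⟩
    · have h1 : ‖γ t‖ ^ 2 = ‖p‖ ^ 2 := by rw [hγn, ← hγ0, hγn]
      rw [← hp.1]
      exact (sq_eq_sq₀ (norm_nonneg _) (norm_nonneg _)).mp h1
    · rw [hγD, ← hγD 0, hγ0]; exact hp.2
  have hγd : ∀ t, HasDerivAt γ (-Real.sin t • a + Real.cos t • w) t := fun t =>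
    (((Real.hasDerivAt_cos t).smul_const a).add ((Real.hasDerivAt_sin t).smul_const w)).add_const b
  have hγdd : HasDerivAt (fun t => -Real.sin t • a + Real.cos t • w) (-a) 0 := by
    have := ((Real.hasDerivAt_sin 0).fun_neg.smul_const a).add
      ((Real.hasDerivAt_cos 0).smul_const w)
    refine this.congr_deriv ?_
    simp
  have hgrad : HasDerivAt (fun t => gradient f (γ t)) (fderiv ℝ (gradient f) p w) 0 := by
    have h1 : HasFDerivAt (gradient f) (fderiv ℝ (gradient f) p) (γ 0) := by
      rw [hγ0]; exact (differentiable_gradient hf p).hasFDerivAt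
    exact (h1.comp_hasDerivAt 0 (hγd 0)).congr_deriv (by simp)
  have hsecond := hgrad.inner ℝ hγdd
  have hnonpos := second_deriv_nonpos_of_isLocalMax (a := 0)
    (fun t => hasDerivAt_comp_gradient hf (hγd t)) hsecond
    (Filter.Eventually.of_forall fun t => by
      have := hmax (hmem t)
      simpa [hγ0] using this)
  simp only [hγ0, Real.sin_zero, Real.cos_zero, neg_zero, zero_smul, one_smul, zero_add,
    inner_neg_right] at hnonpos
  rw [hw, map_smul, inner_smul_left, inner_smul_right] at hnonpos
  simp only [conj_trivial] at hnonpos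
  have h3 : inner ℝ (fderiv ℝ (gradient f) p v) v * (‖a‖ ^ 2 / ‖v‖ ^ 2) ≤
      (inner ℝ (gradient f p) a : ℝ) := by
    calc _ = ‖a‖ / ‖v‖ * (‖a‖ / ‖v‖ * inner ℝ (fderiv ℝ (gradient f) p v) v) := by ring
      _ ≤ _ := by linarith
  rw [div_mul_eq_mul_div, le_div_iff₀ han2]
  rw [mul_div_assoc', div_le_iff₀ (by positivity)] at h3
  linarith

end IsCliffordOp

/-! ### Laplacian and lowest Jacobi eigenvalue of the link. -/

namespace IsCliffordOp

variable {n : ℕ} {D : Euc n →L[ℝ] Euc n} {α : ℝ}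

/-- The orthogonal projection onto the tangent space of the link at `x`, as a linear map. -/
noncomputable def tangentProj (D : Euc n →L[ℝ] Euc n) (x : Euc n) : Euc n →ₗ[ℝ] Euc n where
  toFun v := sphTanProj (fun y => D y) x v
  map_add' v w := by simp only [sphTanProj_link, inner_add_right]; module
  map_smul' c v := by simp only [sphTanProj_link, inner_smul_right, RingHom.id_apply]; module

lemma tangentProj_apply (x v : Euc n) :
    tangentProj D x v = sphTanProj (fun y => D y) x v := rfl

lemma tangentProj_tangentProj (h : IsCliffordOp D α) {x : Euc n} (hx : x ∈ quadricLink D)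
    (v : Euc n) : tangentProj D x (tangentProj D x v) = tangentProj D x v :=
  sphTanProj_eq_self (inner_sphTanProj_left hx v) (h.inner_map_sphTanProj hx v)

lemma inner_tangentProj (x v w : Euc n) :
    inner ℝ (tangentProj D x v) w = (inner ℝ v (tangentProj D x w) : ℝ) := by
  simp only [tangentProj_apply, sphTanProj_link, inner_sub_left, inner_sub_right, inner_smul_left,
    inner_smul_right, conj_trivial, real_inner_comm x v, real_inner_comm (D x) v]
  ring

lemma tangentProj_map (h : IsCliffordOp D α) (x v : Euc n) :
    tangentProj D x (D v) = D (tangentProj D x v) := by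
  simp only [tangentProj_apply, sphTanProj_link, map_sub, map_smul, ← h.symm, h.sq,
    inner_add_left, inner_smul_left, conj_trivial]
  module

lemma tangentProj_posProj (h : IsCliffordOp D α) (x v : Euc n) :
    tangentProj D x (posProj D α v) = posProj D α (tangentProj D x v) := by
  simp only [posProj_apply, map_smul, map_add, h.tangentProj_map x]

lemma tangentProj_neg (x : Euc n) : tangentProj (-D) x = tangentProj D x := by
  ext1 v
  simp only [tangentProj_apply, sphTanProj, neg_apply, inner_neg_left, smul_neg, neg_smul, neg_neg]

lemma quadricLink_neg : quadricLink (-D) = quadricLink D := by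
  ext x
  simp [quadricLink]

/-- The trace of the Hessian over the part of the tangent space in one eigenspace of `D`. -/
lemma trace_hessian_le_of_isMaxOn (h : IsCliffordOp D α) {f : Euc n → ℝ} (hf : ContDiff ℝ ∞ f)
    {p : Euc n} (hp : p ∈ quadricLink D) (hmax : IsMaxOn f (quadricLink D) p) :
    LinearMap.trace ℝ (Euc n) ((fderiv ℝ (gradient f) p).toLinearMap ∘ₗ
      ((posProj D α).toLinearMap ∘ₗ tangentProj D p)) ≤
        ((n : ℝ) - 2) * inner ℝ (gradient f p) (posProj D α p) := by
  have hα := h.pos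
  set A : Euc n →ₗ[ℝ] Euc n := (posProj D α).toLinearMap ∘ₗ tangentProj D p with hA
  set H : Euc n →ₗ[ℝ] Euc n := (fderiv ℝ (gradient f) p).toLinearMap with hH
  have hAapp : ∀ v, A v = posProj D α (tangentProj D p v) := fun v => rfl
  have hAA : A ∘ₗ A = A := by
    ext1 v
    simp only [LinearMap.comp_apply, hAapp, h.tangentProj_posProj p, h.tangentProj_tangentProj hp,
      h.posProj_posProj]
  have hAs : ∀ v w, inner ℝ (A v) w = (inner ℝ v (A w) : ℝ) := by
    intro v w
    rw [hAapp, h.inner_posProj, inner_tangentProj, h.tangentProj_posProj p, hAapp]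
  -- Since `A` is an orthogonal projection, cyclicity turns the trace into a sum of Hessian values
  -- on the vectors `A (b i)`, which are tangent and lie in the `α`-eigenspace, so the circle
  -- estimate applies to each.
  have htr : LinearMap.trace ℝ (Euc n) (H ∘ₗ A) = LinearMap.trace ℝ (Euc n) (A ∘ₗ (H ∘ₗ A)) := by
    conv_lhs => rw [← hAA, ← LinearMap.comp_assoc, LinearMap.trace_comp_comm']
  have htrA : LinearMap.trace ℝ (Euc n) A = (α + α⁻¹)⁻¹ * (α⁻¹ * ((n : ℝ) - 2)) := by
    rw [← coordTrace_eq_trace]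
    simp only [hAapp, posProj_apply]
    rw [coordTrace_smul, coordTrace_add, coordTrace_smul]
    congr 1
    have h1 := h.coordTrace_map_sphTanProj hp
    have h2 : coordTrace (tangentProj D p) = (n : ℝ) - 2 := h.coordTrace_sphTanProj hp
    simp only [tangentProj_apply, h1, h2, zero_add]
  set b := EuclideanSpace.basisFun (Fin n) ℝ
  -- This sum equals `(n - 2) ‖posProj D α p‖²`, so the denominator in the circle estimate cancels
  -- and the factor `n - 2` appears for either eigenspace, whatever its dimension.
  have hsumA : ∑ i, ‖A (b i)‖ ^ 2 = (α + α⁻¹)⁻¹ * (α⁻¹ * ((n : ℝ) - 2)) := by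
    rw [← htrA, LinearMap.trace_eq_sum_inner A b]
    refine Finset.sum_congr rfl fun i _ => ?_
    rw [← real_inner_self_eq_norm_sq, hAs, ← LinearMap.comp_apply, hAA]
  rw [htr, LinearMap.trace_eq_sum_inner _ b]
  have hle : ∀ i, inner ℝ (b i) ((A ∘ₗ (H ∘ₗ A)) (b i)) ≤
      ‖A (b i)‖ ^ 2 / ‖posProj D α p‖ ^ 2 * (inner ℝ (gradient f p) (posProj D α p) : ℝ) := by
    intro i
    rw [LinearMap.comp_apply, ← hAs, LinearMap.comp_apply, real_inner_comm]
    refine h.hessian_le_of_isMaxOn hf hp hmax (h.map_posProj _) ?_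
    rw [hAapp, ← h.tangentProj_posProj p]
    exact inner_sphTanProj_left hp _
  refine (Finset.sum_le_sum fun i _ => hle i).trans_eq ?_
  rw [← Finset.sum_mul, ← Finset.sum_div, hsumA, h.norm_sq_posProj hp]
  field_simp

/-- Differentiating the tangential gradient gives the tangential Hessian and corrections from the
two normal directions `p` and `D p`. The first contributes `n - 2`, the dimension; the second is
multiplied by the tangential trace of `D` and vanishes by minimality. -/
lemma sphLaplacian_link (h : IsCliffordOp D α) {f : Euc n → ℝ} (hf : ContDiff ℝ ∞ f)
    {p : Euc n} (hp : p ∈ quadricLink D) :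
    sphLaplacian (fun y => D y) f p =
      LinearMap.trace ℝ (Euc n) ((fderiv ℝ (gradient f) p).toLinearMap ∘ₗ tangentProj D p) -
        ((n : ℝ) - 2) * inner ℝ p (gradient f p) := by
  set H := fderiv ℝ (gradient f) p with hH
  have hG : HasFDerivAt (gradient f) H p := (differentiable_gradient hf p).hasFDerivAt
  have hder := (hG.sub (((hasFDerivAt_id p).inner ℝ hG).smul (hasFDerivAt_id p))).sub
    ((D.hasFDerivAt.inner ℝ hG).smul D.hasFDerivAt)
  have hfd : fderiv ℝ (fun y => sphTanProj (fun y => D y) y (gradient f y)) p = _ := hder.fderiv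
  have htp : tangentProj D p p = 0 := by
    simp [tangentProj_apply, sphTanProj_link, hp.1, h.symm, hp.2]
  have htD : tangentProj D p (D p) = 0 := by rw [h.tangentProj_map p, htp, map_zero]
  have key : ∀ v, sphTanProj (fun y => D y) p (fderiv ℝ (fun y => sphTanProj (fun y => D y) y
      (gradient f y)) p (sphTanProj (fun y => D y) p v)) =
      (tangentProj D p ∘ₗ (H.toLinearMap ∘ₗ tangentProj D p)) v -
        (inner ℝ p (gradient f p) : ℝ) • sphTanProj (fun y => D y) p v -
        (inner ℝ (D p) (gradient f p) : ℝ) • D (sphTanProj (fun y => D y) p v) := by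
    intro v
    rw [hfd]
    simp only [← tangentProj_apply (D := D)]
    simp [htp, htD, h.tangentProj_map p, h.tangentProj_tangentProj hp]
  rw [sphLaplacian, funext key, coordTrace_sub, coordTrace_sub, coordTrace_smul, coordTrace_smul,
    coordTrace_eq_trace, h.coordTrace_map_sphTanProj hp, h.coordTrace_sphTanProj hp,
    LinearMap.trace_comp_comm', LinearMap.comp_assoc]
  have : tangentProj D p ∘ₗ tangentProj D p = tangentProj D p :=
    LinearMap.ext (h.tangentProj_tangentProj hp)
  rw [this]
  ring

/-- The two eigenspace estimates add up to `(n - 2) ⟪∇f, p⟫`, because the two components of `p` sum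
to `p`. This is exactly the correction term in `sphLaplacian_link`. -/
lemma sphLaplacian_nonpos_of_isMaxOn (h : IsCliffordOp D α) {f : Euc n → ℝ}
    (hf : ContDiff ℝ ∞ f) {p : Euc n} (hp : p ∈ quadricLink D)
    (hmax : IsMaxOn f (quadricLink D) p) : sphLaplacian (fun y => D y) f p ≤ 0 := by
  have h1 := h.trace_hessian_le_of_isMaxOn hf hp hmax
  have h2 := h.neg.trace_hessian_le_of_isMaxOn hf (p := p) (by rwa [quadricLink_neg])
    (by rwa [quadricLink_neg])
  rw [tangentProj_neg] at h2
  have hsplit : (fderiv ℝ (gradient f) p).toLinearMap ∘ₗ tangentProj D p =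
      (fderiv ℝ (gradient f) p).toLinearMap ∘ₗ ((posProj D α).toLinearMap ∘ₗ tangentProj D p) +
      (fderiv ℝ (gradient f) p).toLinearMap ∘ₗ
        ((posProj (-D) α⁻¹).toLinearMap ∘ₗ tangentProj D p) := by
    ext1 v
    simp only [LinearMap.add_apply, LinearMap.comp_apply, ContinuousLinearMap.coe_coe, ← map_add,
      h.posProj_add_posProj_neg]
  have hp' : inner ℝ p (gradient f p) = inner ℝ (gradient f p) (posProj D α p) +
      (inner ℝ (gradient f p) (posProj (-D) α⁻¹ p) : ℝ) := by
    rw [← inner_add_right, h.posProj_add_posProj_neg, real_inner_comm]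
  rw [h.sphLaplacian_link hf hp, hsplit, map_add, hp']
  linarith

lemma sphLaplacian_neg (h : IsCliffordOp D α) {f : Euc n → ℝ} (hf : ContDiff ℝ ∞ f)
    {p : Euc n} (hp : p ∈ quadricLink D) :
    sphLaplacian (fun y => D y) (fun x => -f x) p = -sphLaplacian (fun y => D y) f p := by
  have hg : gradient (fun x => -f x) = fun x => -gradient f x := by
    ext1 x
    simp only [gradient, fderiv_fun_neg, map_neg]
  rw [h.sphLaplacian_link hf hp, h.sphLaplacian_link hf.neg hp, hg, fderiv_fun_neg]
  simp only [inner_neg_right, ContinuousLinearMap.toLinearMap_neg, LinearMap.neg_comp, map_neg]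
  ring

/-- After a change of sign the eigenfunction is positive somewhere, hence at its maximum. Evaluating
the eigenvalue equation there, where the Laplacian is nonpositive, bounds `μ` from below. -/
lemma neg_le_of_isJacobiEigenvalue (h : IsCliffordOp D α) {μ : ℝ}
    (hμ : IsJacobiEigenvalue (quadricLink D) (fun y => D y) μ) : -((n : ℝ) - 2) ≤ μ := by
  obtain ⟨f, hf, ⟨q, hq, hfq⟩, heq⟩ := hμ
  have aux : ∀ g : Euc n → ℝ, ContDiff ℝ ∞ g → 0 < g q → (∀ p ∈ quadricLink D,
      -sphLaplacian (fun y => D y) g p - sphNormSqA (fun y => D y) p * g p = μ * g p) →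
      -((n : ℝ) - 2) ≤ μ := by
    intro g hg hgq hgeq
    obtain ⟨p, hp, hmax⟩ := (isCompact_link D).exists_isMaxOn ⟨q, hq⟩ hg.continuous.continuousOn
    have hpos : 0 < g p := hgq.trans_le (hmax hq)
    have h1 := hgeq p hp
    rw [h.sphNormSqA_link hp] at h1
    have h2 := h.sphLaplacian_nonpos_of_isMaxOn hg hp hmax
    by_contra! hlt
    nlinarith [mul_pos hpos (sub_pos.mpr hlt)]
  rcases hfq.lt_or_gt with hneg | hpos
  · refine aux (fun x => -f x) hf.neg (by simpa using hneg) fun p hp => ?_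
    rw [h.sphLaplacian_neg hf hp]
    linarith [heq p hp]
  · exact aux f hf hpos heq

lemma isLeast_jacobiEigenvalue (h : IsCliffordOp D α) (hne : (quadricLink D).Nonempty) :
    IsLeast {μ : ℝ | IsJacobiEigenvalue (quadricLink D) (fun y => D y) μ} (-((n : ℝ) - 2)) := by
  refine ⟨⟨fun _ => 1, contDiff_const, ?_, fun p hp => ?_⟩,
    fun μ hμ => h.neg_le_of_isJacobiEigenvalue hμ⟩
  · obtain ⟨q, hq⟩ := hne
    exact ⟨q, hq, one_ne_zero⟩
  · have hg : gradient (fun _ : Euc n => (1 : ℝ)) = fun _ => 0 := by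
      ext1 x; simp [gradient]
    rw [h.sphLaplacian_link contDiff_const hp, h.sphNormSqA_link hp, hg]
    simp

end IsCliffordOp

/-! ### The cone as a free boundary minimal hypersurface -/

/-- The part of the cone defined by `D` outside the ball of radius `R₀`. -/
def quadricCone {n : ℕ} (R₀ : ℝ) (D : Euc n →L[ℝ] Euc n) : Set (Euc n) :=
  {x | R₀ ≤ ‖x‖ ∧ inner ℝ x (D x) = (0 : ℝ)}

lemma truncatedCone_quadricLink {n : ℕ} {R₀ : ℝ} (hR : 0 < R₀) (D : Euc n →L[ℝ] Euc n) :
    truncatedCone R₀ (quadricLink D) = quadricCone R₀ D := by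
  ext x
  constructor
  · rintro ⟨hx, t, ht, y, hy, rfl⟩
    refine ⟨hx, ?_⟩
    rw [map_smul, inner_smul_left, inner_smul_right, hy.2]; simp
  · rintro ⟨hx, hq⟩
    have hpos : 0 < ‖x‖ := hR.trans_le hx
    refine ⟨hx, ‖x‖, hpos, ‖x‖⁻¹ • x, ⟨?_, ?_⟩, ?_⟩
    · rw [norm_smul, norm_inv, norm_norm, inv_mul_cancel₀ hpos.ne']
    · rw [map_smul, inner_smul_left, inner_smul_right, hq]; simp
    · rw [smul_smul, mul_inv_cancel₀ hpos.ne', one_smul]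

/-- The unit normal of the cone defined by `D` with respect to the Schwarzschild metric. -/
noncomputable def coneNormal (n : ℕ) (m : ℝ) (D : Euc n →L[ℝ] Euc n) (x : Euc n) : Euc n :=
  (schwFactor n m x * ‖x‖)⁻¹ • D x

lemma contDiffAt_schwFactor {n : ℕ} {m : ℝ} (hm : 0 < m) {x : Euc n} (hx : x ≠ 0) :
    ContDiffAt ℝ ∞ (schwFactor n m) x := by
  have hr := norm_pos_iff.mpr hx
  have hn : ContDiffAt ℝ ∞ (fun y : Euc n => ‖y‖) x := contDiffAt_norm ℝ hx
  unfold schwFactor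
  refine ContDiffAt.rpow_const_of_ne ?_ (by positivity)
  exact contDiffAt_const.add (contDiffAt_const.div (contDiffAt_const.mul (hn.pow _))
    (by positivity))

lemma hasFDerivAt_inv_schwFactor_mul_norm {n : ℕ} (hn : 2 < n) {m : ℝ} (hm : 0 < m) {x : Euc n}
    (hx : x ≠ 0) :
    HasFDerivAt (fun y => (schwFactor n m y * ‖y‖)⁻¹)
      ((-(schwTau n m ‖x‖ * (schwFactor n m x * ‖x‖)⁻¹ / ‖x‖ ^ 2)) • innerSL ℝ x) x := by
  have hr := norm_pos_iff.mpr hx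
  have hf := schwProfile_pos (n := n) hm hr
  have h1 := ((hasDerivAt_schwProfile hn hm hr).mul (hasDerivAt_id ‖x‖)).fun_inv
    (by simp; constructor <;> positivity)
  refine (hasFDerivAt_radial hx h1).congr_fderiv ?_
  congr 1
  simp only [schwFactor_eq_profile, id, Pi.mul_apply]
  field_simp
  ring

/-- The covariant derivative of `(f |x|)⁻¹ L x`, for a linear map `L`. -/
lemma covDeriv_smul_linear {n : ℕ} (hn : 2 < n) {m : ℝ} (hm : 0 < m) (L : Euc n →L[ℝ] Euc n)
    {x : Euc n} (hx : x ≠ 0) (v : Euc n) :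
    covDeriv (schwMetric n m) (fun y => (schwFactor n m y * ‖y‖)⁻¹ • L y) x v =
      (schwFactor n m x * ‖x‖)⁻¹ • (L v - (inner ℝ x v / ‖x‖ ^ 2 : ℝ) • L x +
        schwCoeff n m ‖x‖ • ((inner ℝ x (L x) : ℝ) • v - (inner ℝ v (L x) : ℝ) • x)) := by
  have hr := norm_pos_iff.mpr hx
  rw [covDeriv, christoffel_schwMetric hn hm hx,
    ((hasFDerivAt_inv_schwFactor_mul_norm hn hm hx).fun_smul L.hasFDerivAt).fderiv]
  simp only [add_apply, smul_apply, ContinuousLinearMap.smulRight_apply, innerSL_apply_apply,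
    smul_eq_mul, inner_smul_right]
  -- The derivative of `(f |x|)⁻¹` contributes `-τ / |x|²` and the Christoffel term `(τ - 1) /
  -- |x|²`, so `τ` drops out of the coefficient of `L x`.
  match_scalars <;> ((try rw [schwCoeff]); field_simp; try ring)

namespace IsCliffordOp

variable {n : ℕ} {D : Euc n →L[ℝ] Euc n} {α m : ℝ}

section Pointwise

variable {x : Euc n}

lemma tanProj_cone (hm : 0 < m) (hx : x ≠ 0) (v : Euc n) :
    tanProj (schwMetric n m) (coneNormal n m D) x v =
      v - (inner ℝ (D x) v / ‖x‖ ^ 2 : ℝ) • D x := by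
  have hr := norm_pos_iff.mpr hx
  have hf : 0 < schwFactor n m x := schwProfile_pos hm hr
  rw [tanProj, coneNormal, schwMetric, inner_smul_left, smul_smul]
  congr 2
  simp
  field_simp

lemma inner_tanProj_cone (h : IsCliffordOp D α) (hm : 0 < m) (hx : x ≠ 0)
    (hq : inner ℝ x (D x) = (0 : ℝ)) (v : Euc n) :
    inner ℝ (D x) (tanProj (schwMetric n m) (coneNormal n m D) x v) = (0 : ℝ) := by
  have hr := norm_pos_iff.mpr hx
  rw [tanProj_cone hm hx, inner_sub_right, inner_smul_right, real_inner_self_eq_norm_sq,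
    h.norm_map hq]
  field_simp
  ring

/-- The shape operator of the cone is a multiple of `P D P`, where `P` is the orthogonal projection
onto the tangent space. -/
lemma shapeOp_cone (h : IsCliffordOp D α) (hn : 2 < n) (hm : 0 < m) (hx : x ≠ 0)
    (hq : inner ℝ x (D x) = (0 : ℝ)) (v : Euc n) :
    shapeOp (schwMetric n m) (coneNormal n m D) x v =
      -(schwFactor n m x * ‖x‖)⁻¹ • (D v - (inner ℝ (D x) v / ‖x‖ ^ 2 : ℝ) • x -
        (inner ℝ x v / ‖x‖ ^ 2 : ℝ) • D x -
        ((α - α⁻¹) * inner ℝ (D x) v / ‖x‖ ^ 2 : ℝ) • D x) := by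
  have hr := norm_pos_iff.mpr hx
  have h0 := h.inner_tanProj_cone hm hx hq v
  have hcov := covDeriv_smul_linear hn hm D hx (tanProj (schwMetric n m) (coneNormal n m D) x v)
  rw [hq, real_inner_comm (D x), h0] at hcov
  unfold shapeOp
  change tanProj _ _ _ (-covDeriv _ (fun y => (schwFactor n m y * ‖y‖)⁻¹ • D y) _ _) = _
  rw [hcov, tanProj_cone hm hx, tanProj_cone hm hx]
  simp only [map_sub, map_smul, h.sq, inner_neg_right, inner_smul_right, inner_add_right,
    inner_sub_right, hq, h.inner_map_map, real_inner_self_eq_norm_sq, real_inner_comm x (D x)]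
  match_scalars <;> field_simp <;> ring

lemma meanCurvature_cone (h : IsCliffordOp D α) (hn : 2 < n) (hm : 0 < m) (hx : x ≠ 0)
    (hq : inner ℝ x (D x) = (0 : ℝ)) :
    meanCurvature (schwMetric n m) (coneNormal n m D) x = 0 := by
  have hr := norm_pos_iff.mpr hx
  rw [meanCurvature, funext (h.shapeOp_cone hn hm hx hq), coordTrace_smul, coordTrace_sub,
    coordTrace_sub, coordTrace_sub, h.trace]
  simp only [div_eq_inv_mul, mul_smul, coordTrace_smul, coordTrace_rankOne]
  rw [real_inner_comm x (D x), hq, real_inner_self_eq_norm_sq, h.norm_map hq]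
  field_simp
  ring

/-- The ray direction lies in the kernel of the shape operator, so only the `n - 2` of the link
survives, rescaled by the radius `f |x|`. -/
lemma normSqA_cone (h : IsCliffordOp D α) (hn : 2 < n) (hm : 0 < m) (hx : x ≠ 0)
    (hq : inner ℝ x (D x) = (0 : ℝ)) :
    normSqA (schwMetric n m) (coneNormal n m D) x =
      ((n : ℝ) - 2) / (schwFactor n m x * ‖x‖) ^ 2 := by
  have hr := norm_pos_iff.mpr hx
  have hf : 0 < schwFactor n m x := schwProfile_pos hm hr
  have key : ∀ v, shapeOp (schwMetric n m) (coneNormal n m D) x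
      (shapeOp (schwMetric n m) (coneNormal n m D) x v) =
      ((schwFactor n m x * ‖x‖) ^ 2)⁻¹ • ((α - α⁻¹) • D v + v
        - ((α - α⁻¹) * (‖x‖ ^ 2)⁻¹) • ((inner ℝ (D x) v : ℝ) • x)
        - (‖x‖ ^ 2)⁻¹ • ((inner ℝ x v : ℝ) • x)
        - ((1 + (α - α⁻¹) ^ 2) * (‖x‖ ^ 2)⁻¹) • ((inner ℝ (D x) v : ℝ) • D x)
        - ((α - α⁻¹) * (‖x‖ ^ 2)⁻¹) • ((inner ℝ x v : ℝ) • D x)) := by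
    intro v
    rw [h.shapeOp_cone hn hm hx hq, h.shapeOp_cone hn hm hx hq]
    simp only [map_sub, map_smul, map_neg, neg_smul, h.sq, inner_neg_right, inner_smul_right,
      inner_sub_right, hq, h.inner_map_map, ← h.symm, real_inner_self_eq_norm_sq,
      real_inner_comm x (D x)]
    match_scalars <;> field_simp <;> ring
  rw [normSqA, funext key]
  simp only [coordTrace_smul, coordTrace_sub, coordTrace_add, coordTrace_rankOne, h.trace, hq,
    real_inner_comm x (D x), real_inner_self_eq_norm_sq, h.norm_map hq, coordTrace_id]
  field_simp
  ring

end Pointwise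

variable {R₀ : ℝ}

lemma isInteriorPoint_cone (h : IsCliffordOp D α) (hR : 0 < R₀) {p : Euc n}
    (hp : p ∈ quadricCone R₀ D) (hpR : R₀ < ‖p‖) :
    IsInteriorPoint (quadricCone R₀ D) p {v | inner ℝ (D p) v = (0 : ℝ)} := by
  refine ⟨{x | R₀ < ‖x‖}, fun y => inner ℝ y (D y), isOpen_lt continuous_const continuous_norm,
    hpR, (contDiff_quadratic D).contDiffOn, hp.2, fun h0 => ?_, ?_, ?_⟩
  · have h1 := h.fderiv_quadratic p (D p)
    rw [h0, real_inner_self_eq_norm_sq, h.norm_map hp.2] at h1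
    have : 0 < ‖p‖ := hR.trans hpR
    simp at h1
    exact this.ne' (norm_eq_zero.mpr h1)
  · ext y
    simp only [quadricCone, Set.mem_inter_iff, Set.mem_ofPred_eq]
    exact ⟨fun hy => ⟨hy.2, hy.1.2⟩, fun hy => ⟨⟨hy.1.le, hy.2⟩, hy.1⟩⟩
  · ext v; simp [h.fderiv_quadratic]

lemma isBoundaryPoint_cone (h : IsCliffordOp D α) (hR : 0 < R₀) {p : Euc n}
    (hp : p ∈ quadricCone R₀ D) (hpR : ‖p‖ = R₀) :
    IsBoundaryPoint (quadricCone R₀ D) p {v | inner ℝ (D p) v = (0 : ℝ)} := by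
  have hψ : ∀ v, fderiv ℝ (fun y : Euc n => ‖y‖ ^ 2 - R₀ ^ 2) p v = 2 * inner ℝ p v := by
    intro v
    rw [fderiv_sub_const, (hasStrictFDerivAt_norm_sq p).hasFDerivAt.fderiv]
    simp
  refine ⟨Set.univ, fun y => inner ℝ y (D y), fun y => ‖y‖ ^ 2 - R₀ ^ 2, isOpen_univ, trivial,
    (contDiff_quadratic D).contDiffOn, ((contDiff_norm_sq ℝ).sub contDiff_const).contDiffOn, hp.2,
    by simp [hpR], ?_, ?_, ?_⟩
  · rw [LinearIndependent.pair_iff]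
    intro s t hst
    -- Evaluation at `D p` and at `p`, which are orthogonal on the cone, isolates the two
    -- coefficients.
    have h1 := congrArg (fun L : Euc n →L[ℝ] ℝ => L (D p)) hst
    have h2 := congrArg (fun L : Euc n →L[ℝ] ℝ => L p) hst
    simp only [add_apply, smul_apply, h.fderiv_quadratic, hψ, zero_apply, hp.2,
      real_inner_comm p (D p), real_inner_self_eq_norm_sq, h.norm_map hp.2, hpR, smul_eq_mul]
      at h1 h2
    constructor
    · simpa [hR.ne'] using h1
    · simpa [hR.ne'] using h2
  · ext y
    simp only [quadricCone, Set.mem_inter_iff, Set.mem_ofPred_eq, Set.mem_univ, and_true, true_and,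
      sub_nonneg]
    rw [sq_le_sq₀ hR.le (norm_nonneg y), and_comm]
  · ext v; simp [h.fderiv_quadratic]

lemma isClosed_quadricCone (R₀ : ℝ) (D : Euc n →L[ℝ] Euc n) : IsClosed (quadricCone R₀ D) :=
  (isClosed_le continuous_const continuous_norm).inter
    (isClosed_eq (contDiff_quadratic D).continuous continuous_const)

lemma isUnitNormal_cone (h : IsCliffordOp D α) (hm : 0 < m) (hR : 0 < R₀) :
    IsUnitNormal (schwMetric n m) (quadricCone R₀ D) (coneNormal n m D) where
  smooth := by
    refine ⟨{x | x ≠ 0}, isOpen_ne, fun x hx => norm_pos_iff.mp (hR.trans_le hx.1),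
      fun x hx => ContDiffAt.contDiffWithinAt ?_⟩
    have hr := norm_pos_iff.mpr hx
    have hf : 0 < schwFactor n m x := schwProfile_pos hm hr
    exact (((contDiffAt_schwFactor hm hx).mul (contDiffAt_norm ℝ hx)).inv (by positivity)).smul
      D.contDiff.contDiffAt
  unit p hp := by
    have hr : 0 < ‖p‖ := hR.trans_le hp.1
    have hf : 0 < schwFactor n m p := schwProfile_pos hm hr
    rw [schwMetric, coneNormal, real_inner_self_eq_norm_sq, norm_smul, h.norm_map hp.2, norm_inv,
      Real.norm_of_nonneg (by positivity)]
    field_simp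
  normal p hp := by
    refine ⟨{v | inner ℝ (D p) v = (0 : ℝ)}, ?_, fun v hv => ?_⟩
    · rcases hp.1.lt_or_eq with h1 | h1
      · exact Or.inl (h.isInteriorPoint_cone hR hp h1)
      · exact Or.inr (h.isBoundaryPoint_cone hR hp h1.symm)
    · rw [schwMetric, coneNormal, inner_smul_left, hv.out]; simp

lemma isFreeBoundaryMinimal_cone (h : IsCliffordOp D α) (hn : 2 < n) (hm : 0 < m)
    (hne : (quadricLink D).Nonempty) :
    IsFreeBoundaryMinimal n m (quadricCone (horizonRadius n m) D) (coneNormal n m D) := by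
  have hR := horizonRadius_pos n hm
  obtain ⟨q, hq⟩ := hne
  have hmem : horizonRadius n m • q ∈ quadricCone (horizonRadius n m) D ∧
      ‖horizonRadius n m • q‖ = horizonRadius n m := by
    have hnorm : ‖horizonRadius n m • q‖ = horizonRadius n m := by
      rw [norm_smul, hq.1, mul_one, Real.norm_of_nonneg hR.le]
    refine ⟨⟨hnorm.ge, ?_⟩, hnorm⟩
    rw [map_smul, inner_smul_left, inner_smul_right, hq.2]; simp
  exact
    { properly_embedded :=
        { nonempty := ⟨_, hmem.1⟩
          isClosed := isClosed_quadricCone _ D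
          subset := fun p hp => hp.1
          interior_point := fun p hp hpR => ⟨_, h.isInteriorPoint_cone hR hp hpR⟩
          boundary_point := fun p hp hpR => ⟨_, h.isBoundaryPoint_cone hR hp hpR⟩ }
      unit_normal := h.isUnitNormal_cone hm hR
      minimal := fun p hp =>
        h.meanCurvature_cone hn hm (norm_pos_iff.mp (hR.trans_le hp.1)) hp.2
      boundary_nonempty := ⟨_, hmem⟩
      orthogonal := fun p hp _ => by
        rw [schwMetric, coneNormal, radialNormal, inner_smul_left, inner_smul_right,
          real_inner_comm, hp.2]
        simp }

/-- If the second fundamental form vanished, pairing each shape operator value with itself would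
make it zero, contradicting `|A|² > 0`. -/
lemma not_isTotallyGeodesic_cone (h : IsCliffordOp D α) (hn : 2 < n) (hm : 0 < m) (hR : 0 < R₀)
    (hne : (quadricCone R₀ D).Nonempty) :
    ¬ IsTotallyGeodesic (schwMetric n m) (quadricCone R₀ D) (coneNormal n m D) := by
  intro htg
  obtain ⟨p, hp⟩ := hne
  have hr : 0 < ‖p‖ := hR.trans_le hp.1
  have hp0 := norm_pos_iff.mp hr
  have hf : 0 < schwFactor n m p := schwProfile_pos hm hr
  have hn' : (2 : ℝ) < n := by exact_mod_cast hn
  set P := tanProj (schwMetric n m) (coneNormal n m D) p with hP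
  have hnormal : ∀ v, schwMetric n m p (coneNormal n m D p) (P v) = 0 := fun v => by
    rw [schwMetric, coneNormal, inner_smul_left, h.inner_tanProj_cone hm hp0 hp.2]; simp
  have hzero : ∀ v, shapeOp (schwMetric n m) (coneNormal n m D) p v = 0 := by
    intro v
    set s := shapeOp (schwMetric n m) (coneNormal n m D) p v with hs
    have hsP : s = P (-covDeriv (schwMetric n m) (coneNormal n m D) p (P v)) := rfl
    have h1 := htg p hp (P v) s (hnormal _) (hsP ▸ hnormal _)
    rw [secondFF] at h1
    set c := covDeriv (schwMetric n m) (coneNormal n m D) p (P v)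
    have h2 : s = -c + (inner ℝ (D p) c / ‖p‖ ^ 2 : ℝ) • D p := by
      rw [hsP, hP, tanProj_cone hm hp0, inner_neg_right]; module
    have h3 : inner ℝ (D p) s = (0 : ℝ) := hsP ▸ h.inner_tanProj_cone hm hp0 hp.2 _
    have h4 : inner ℝ c s = (0 : ℝ) := by
      simpa [schwMetric, hf.ne'] using h1
    have h5 : inner ℝ s s = (0 : ℝ) := by
      nth_rewrite 1 [h2]
      rw [inner_add_left, inner_neg_left, inner_smul_left, h3, h4]; simp
    exact inner_self_eq_zero.mp h5
  have h6 := h.normSqA_cone hn hm hp0 hp.2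
  rw [normSqA, funext fun v => hzero _] at h6
  have h7 : coordTrace (fun _ : Euc n => (0 : Euc n)) = 0 := by simp [coordTrace]
  rw [h7] at h6
  have : 0 < ((n : ℝ) - 2) / (schwFactor n m p * ‖p‖) ^ 2 :=
    div_pos (by linarith) (by positivity)
  linarith

end IsCliffordOp

/-- The horizon is totally geodesic. -/
lemma secondFF_radialNormal_horizon {n : ℕ} (hn : 2 < n) {m : ℝ} (hm : 0 < m) {x v : Euc n}
    (hx : ‖x‖ = horizonRadius n m) (hv : inner ℝ x v = (0 : ℝ)) (w : Euc n) :
    secondFF (schwMetric n m) (radialNormal n m) x v w = 0 := by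
  have hr : 0 < ‖x‖ := hx ▸ horizonRadius_pos n hm
  have hcov := covDeriv_smul_linear hn hm (ContinuousLinearMap.id ℝ (Euc n))
    (norm_pos_iff.mp hr) v
  simp only [ContinuousLinearMap.id_apply] at hcov
  unfold secondFF
  change -schwMetric n m x (covDeriv _ (fun y => (schwFactor n m y * ‖y‖)⁻¹ • y) _ _) w = _
  have hτ : schwCoeff n m ‖x‖ * ‖x‖ ^ 2 = -1 := by
    rw [schwCoeff, hx, schwTau_horizonRadius hn hm, ← hx]
    field_simp
    ring
  have hzero : v - (inner ℝ x v / ‖x‖ ^ 2 : ℝ) • x + schwCoeff n m ‖x‖ •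
      ((inner ℝ x x : ℝ) • v - (inner ℝ v x : ℝ) • x) = 0 := by
    rw [real_inner_comm x v, hv, real_inner_self_eq_norm_sq, zero_smul, sub_zero, smul_smul, hτ]
    simp
  rw [hcov, hzero]
  simp [schwMetric]

/-! ### Hausdorff measure on cones -/

section Dilation

variable {E : Type*} [NormedAddCommGroup E] [NormedSpace ℝ E] [MeasurableSpace E] [BorelSpace E]

lemma integral_comp_smul_euclideanHausdorffMeasure (d : ℕ) {c : ℝ} (hc : 0 < c) (F : E → ℝ) :
    c ^ d * ∫ x, F (c • x) ∂(Measure.euclideanHausdorffMeasure d) =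
      ∫ x, F x ∂(Measure.euclideanHausdorffMeasure d) := by
  have hmap : Measure.map (fun x : E => c • x) (Measure.euclideanHausdorffMeasure d) =
      (c.toNNReal⁻¹ ^ d) • (Measure.euclideanHausdorffMeasure d : Measure E) := by
    ext s hs
    have hmeas : Measurable fun x : E => c • x := measurable_const_smul c
    rw [Measure.map_apply hmeas hs, Set.preimage_smul₀ hc.ne',
      Measure.euclideanHausdorffMeasure_smul₀ d (inv_ne_zero hc.ne'), Measure.smul_apply]
    congr 2
    ext
    simp [hc.le, abs_of_pos hc]
  have hemb : MeasurableEmbedding fun x : E => c • x :=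
    (Homeomorph.smulOfNeZero c hc.ne').measurableEmbedding
  rw [← hemb.integral_map, hmap, integral_smul_nnreal_measure, NNReal.smul_def, smul_eq_mul]
  have : ((c.toNNReal⁻¹ ^ d : NNReal) : ℝ) = (c ^ d)⁻¹ := by simp [hc.le]
  rw [this, mul_inv_cancel_left₀ (by positivity)]

/-- Each radius receives the same total weight under the scale-invariant measure `dt / t`. The lower
limit `a / 2` is needed because `t` runs down to `r / 2`. -/
lemma setIntegral_inv_of_mem_annulus {a b r : ℝ} (ha : 0 < a) (har : a ≤ r) (hrb : r ≤ b) :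
    ∫ t in Set.Icc (a / 2) b, (if t ≤ r ∧ r ≤ 2 * t then t⁻¹ else 0) = Real.log 2 := by
  have hr : 0 < r := ha.trans_le har
  have h1 : (fun t : ℝ => if t ≤ r ∧ r ≤ 2 * t then t⁻¹ else 0) =
      (Set.Icc (r / 2) r).indicator fun t => t⁻¹ := by
    ext t
    rw [Set.indicator_apply]
    refine if_congr ?_ rfl rfl
    rw [Set.mem_Icc]
    constructor <;> rintro ⟨h, h'⟩ <;> constructor <;> linarith
  rw [h1, setIntegral_indicator measurableSet_Icc, Set.inter_eq_self_of_subset_right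
    (Set.Icc_subset_Icc (by linarith) hrb), integral_Icc_eq_integral_Ioc,
    ← intervalIntegral.integral_of_le (by linarith), integral_inv_of_pos (by linarith) hr]
  congr 1
  field_simp

/-- If a bounded function on a cone has nonnegative integral along each ray, with respect to
`t ^ (d - 1) dt`, then it has nonnegative integral with respect to the `d`-dimensional measure. -/
lemma integral_nonneg_of_forall_ray {d : ℕ} {F : E → ℝ} (hF : Measurable F) {B : ℝ}
    (hB : ∀ x, |F x| ≤ B) {a b : ℝ} (ha : 0 < a) {A K : Set E}
    (hK : MeasurableSet K) (hAfin : Measure.euclideanHausdorffMeasure (d + 1) A < ⊤)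
    (hKfin : Measure.euclideanHausdorffMeasure (d + 1) K < ⊤)
    (hFA : ∀ x, x ∉ A → F x = 0) (hAab : ∀ x ∈ A, a ≤ ‖x‖ ∧ ‖x‖ ≤ b)
    (hKA : ∀ (x : E) (t : ℝ), 0 < t → t • x ∈ A → 1 ≤ ‖x‖ → ‖x‖ ≤ 2 → x ∈ K)
    (hray : ∀ x ∈ K, 1 ≤ ‖x‖ → ‖x‖ ≤ 2 → 0 ≤ ∫ t in Set.Icc (a / 2) b, t ^ d * F (t • x)) :
    0 ≤ ∫ x, F x ∂(Measure.euclideanHausdorffMeasure (d + 1)) := by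
  set μ : Measure E := Measure.euclideanHausdorffMeasure (d + 1) with hμ
  set J := Set.Icc (a / 2) b with hJ
  have hB0 : 0 ≤ B := (abs_nonneg _).trans (hB 0)
  have hJpos : ∀ t ∈ J, 0 < t := fun t ht => lt_of_lt_of_le (by positivity) ht.1
  have : IsFiniteMeasure (μ.restrict A) := isFiniteMeasure_restrict.mpr hAfin.ne
  have : IsFiniteMeasure (μ.restrict K) := isFiniteMeasure_restrict.mpr hKfin.ne
  have : IsFiniteMeasure ((volume : Measure ℝ).restrict J) :=
    isFiniteMeasure_restrict.mpr (by simp [hJ])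
  -- `G` spreads `F x` over the dilations `t` for which `x / t` lies in the annulus `1 ≤ ‖y‖ ≤ 2`;
  -- `G'` is the same quantity after the substitution `x = t y`.
  set G : E → ℝ → ℝ := fun x t => if t ∈ J ∧ t ≤ ‖x‖ ∧ ‖x‖ ≤ 2 * t then F x * t⁻¹ else 0 with hG
  set G' : E → ℝ → ℝ := fun x t => if t ∈ J ∧ 1 ≤ ‖x‖ ∧ ‖x‖ ≤ 2 then t ^ d * F (t • x) else 0
    with hG'
  have hGint : Integrable (Function.uncurry G) ((μ.restrict A).prod (volume.restrict J)) := by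
    refine Integrable.of_bound (C := B * (2 / a)) (Measurable.aestronglyMeasurable ?_)
      (Filter.Eventually.of_forall fun p => ?_)
    · refine Measurable.ite ?_ ((hF.comp measurable_fst).mul measurable_snd.inv) measurable_const
      refine (measurable_snd measurableSet_Icc).inter (MeasurableSet.inter ?_ ?_)
      · exact measurableSet_le measurable_snd measurable_fst.norm
      · exact measurableSet_le measurable_fst.norm (measurable_snd.const_mul 2)
    · simp only [Function.uncurry, hG]
      split_ifs with h
      · rw [norm_mul, norm_inv, Real.norm_of_nonneg (hJpos _ h.1).le]
        refine mul_le_mul (hB _) ?_ (inv_nonneg.mpr (hJpos _ h.1).le) hB0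
        rw [← inv_div]
        exact inv_anti₀ (by positivity) h.1.1
      · simp; positivity
  have hG'int : Integrable (Function.uncurry G') ((μ.restrict K).prod (volume.restrict J)) := by
    refine Integrable.of_bound (C := |b| ^ d * B) (Measurable.aestronglyMeasurable ?_)
      (Filter.Eventually.of_forall fun p => ?_)
    · refine Measurable.ite ?_ ((measurable_snd.pow_const d).mul
        (hF.comp (measurable_snd.smul measurable_fst))) measurable_const
      refine (measurable_snd measurableSet_Icc).inter (MeasurableSet.inter ?_ ?_)
      · exact measurableSet_le measurable_const measurable_fst.norm
      · exact measurableSet_le measurable_fst.norm measurable_const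
    · simp only [Function.uncurry, hG']
      split_ifs with h
      · have h0 := (hJpos _ h.1).le
        rw [norm_mul, norm_pow, Real.norm_of_nonneg h0]
        exact mul_le_mul (pow_le_pow_left₀ h0 (h.1.2.trans (le_abs_self b)) d) (hB _)
          (norm_nonneg _) (by positivity)
      · simp; positivity
  have hlog : ∀ x, ∫ t in J, G x t = Real.log 2 * F x := by
    intro x
    by_cases hx : x ∈ A
    · rw [← setIntegral_inv_of_mem_annulus ha (hAab x hx).1 (hAab x hx).2, mul_comm,
        ← integral_const_mul]
      refine setIntegral_congr_fun measurableSet_Icc fun t ht => ?_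
      simp only [hG, ht, true_and, mul_ite, mul_zero]
    · simp [hG, hFA x hx]
  -- Dilation by `t` scales the measure by `t ^ (d + 1)`; together with the weight `t⁻¹` this gives
  -- the factor `t ^ d`.
  have hslice : ∀ t ∈ J, ∫ x in A, G x t ∂μ = ∫ x in K, G' x t ∂μ := by
    intro t ht
    have ht0 := hJpos t ht
    rw [setIntegral_eq_integral_of_forall_compl_eq_zero,
      ← integral_comp_smul_euclideanHausdorffMeasure (d + 1) ht0, ← integral_const_mul, setIntegral_eq_integral_of_forall_compl_eq_zero]
    · refine integral_congr_ae (Filter.Eventually.of_forall fun x => ?_)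
      have h1 : t ≤ t * ‖x‖ ↔ 1 ≤ ‖x‖ := le_mul_iff_one_le_right ht0
      have h2 : t * ‖x‖ ≤ 2 * t ↔ ‖x‖ ≤ 2 := by
        rw [mul_comm 2 t]; exact mul_le_mul_iff_right₀ ht0
      simp only [hG, hG', norm_smul, Real.norm_of_nonneg ht0.le, h1, h2, mul_ite, mul_zero]
      refine if_congr Iff.rfl ?_ rfl
      field_simp
      ring
    · intro x hx
      simp only [hG', ite_eq_right_iff]
      intro h
      rw [hFA, mul_zero]
      exact fun hmem => hx (hKA x t ht0 hmem h.2.1 h.2.2)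
    · intro x hx
      simp [hG, hFA x hx]
  -- Two applications of Fubini, with the change of variables between them, express the integral
  -- through ray integrals over the annulus.
  have hmain : Real.log 2 * ∫ x, F x ∂μ = ∫ x in K, (∫ t in J, G' x t) ∂μ := by
    rw [integral_integral_swap hG'int, ← setIntegral_congr_fun measurableSet_Icc hslice,
      ← integral_integral_swap hGint, ← setIntegral_eq_integral_of_forall_compl_eq_zero hFA,
      ← integral_const_mul]
    exact integral_congr_ae (Filter.Eventually.of_forall fun x => (hlog x).symm)
  have hnonneg : 0 ≤ Real.log 2 * ∫ x, F x ∂μ := by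
    rw [hmain]
    refine setIntegral_nonneg hK fun x hx => ?_
    by_cases h : 1 ≤ ‖x‖ ∧ ‖x‖ ≤ 2
    · refine (hray x hx h.1 h.2).trans_eq (setIntegral_congr_fun measurableSet_Icc fun t ht => ?_)
      simp [hG', ht, h]
    · have : ∀ t, G' x t = 0 := fun t => by simp only [hG', h, and_false, if_false]
      simp [this]
  exact nonneg_of_mul_nonneg_right hnonneg (Real.log_pos one_lt_two)

end Dilation

/-- A set which near `x` is parametrized by a `C¹` map from a `d`-dimensional space has locally
finite `d`-dimensional measure. -/
lemma finiteAtFilter_of_local_parametrization {E V : Type*} [NormedAddCommGroup E]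
    [InnerProductSpace ℝ E] [MeasurableSpace E] [BorelSpace E] [NormedAddCommGroup V]
    [InnerProductSpace ℝ V] [FiniteDimensional ℝ V] {s : Set E} {x : E} {Ψ : V → E} {σ : E → V}
    (hΨ : ContDiffAt ℝ 1 Ψ (σ x)) (hσ : ContinuousAt σ x)
    (hs : ∀ᶠ y in nhdsWithin x s, Ψ (σ y) = y) :
    (Measure.euclideanHausdorffMeasure (Module.finrank ℝ V) : Measure E).FiniteAtFilter
      (nhdsWithin x s) := by
  borelize V
  obtain ⟨L, t, ht, hL⟩ := hΨ.exists_lipschitzOnWith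
  obtain ⟨ε, hε, hball⟩ := Metric.mem_nhds_iff.mp ht
  refine ⟨Ψ '' Metric.ball (σ x) ε, ?_, ?_⟩
  · have h1 : ∀ᶠ y in nhdsWithin x s, σ y ∈ Metric.ball (σ x) ε :=
      (hσ.eventually (Metric.ball_mem_nhds _ hε)).filter_mono nhdsWithin_le_nhds
    filter_upwards [h1, hs] with y hy hy'
    exact ⟨σ y, hy, hy'⟩
  · have h2 := (hL.mono hball).hausdorffMeasure_image_le (d := Module.finrank ℝ V) (by positivity)
    have h3 : Measure.hausdorffMeasure (Module.finrank ℝ V : ℝ) (Metric.ball (σ x) ε) < ⊤ :=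
      measure_ball_lt_top
    rw [Measure.euclideanHausdorffMeasure_def, Measure.smul_apply, ENNReal.smul_def, smul_eq_mul]
    refine ENNReal.mul_lt_top ENNReal.coe_lt_top (h2.trans_lt (ENNReal.mul_lt_top ?_ h3))
    exact ENNReal.rpow_lt_top_of_nonneg (by positivity) ENNReal.coe_ne_top

/-- Away from the origin the cone is locally a graph over a hyperplane `e^⊥`, with `e` in the
eigenspace of `-α⁻¹`: writing `y = w + s e`, the equation of the cone becomes `s² = α ⟪w, D w⟫`. -/
lemma IsCliffordOp.measure_lt_top_of_isCompact {n : ℕ} (hn : 1 ≤ n) {D : Euc n →L[ℝ] Euc n} {α : ℝ}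
    (h : IsCliffordOp D α) {K : Set (Euc n)} (hK : IsCompact K)
    (hKD : ∀ x ∈ K, x ≠ 0 ∧ inner ℝ x (D x) = (0 : ℝ)) :
    Measure.euclideanHausdorffMeasure (n - 1) K < ⊤ := by
  refine hK.measure_lt_top_of_nhdsWithin fun x hx => ?_
  obtain ⟨hx0, hq⟩ := hKD x hx
  have hα := h.pos
  have hr := norm_pos_iff.mpr hx0
  -- A positive multiple of the component of `x` in the eigenspace of `-α⁻¹`. Hence `⟪e₀, x⟫ > 0`,
  -- which selects the positive square root near `x`.
  set e₀ : Euc n := α • x - D x with he₀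
  have hxe₀ : 0 < (inner ℝ e₀ x : ℝ) := by
    rw [he₀, inner_sub_left, inner_smul_left, h.symm, hq, real_inner_self_eq_norm_sq]
    simp; positivity
  have he₀0 : e₀ ≠ 0 := by rintro h0; rw [h0] at hxe₀; simp at hxe₀
  have hDe₀ : D e₀ = -(α⁻¹ • e₀) := by
    rw [he₀, map_sub, map_smul, h.sq]
    match_scalars <;> (field_simp; try ring)
  have he₀n := norm_pos_iff.mpr he₀0
  set e : Euc n := ‖e₀‖⁻¹ • e₀ with he
  have hen : ‖e‖ = 1 := by rw [he, norm_smul, norm_inv, norm_norm, inv_mul_cancel₀ he₀n.ne']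
  have hDe : D e = -(α⁻¹ • e) := by rw [he, map_smul, hDe₀]; module
  have hxe : 0 < (inner ℝ e x : ℝ) := by
    rw [he, inner_smul_left]; simp; positivity
  set V := (ℝ ∙ e)ᗮ with hV
  have hfin : Module.finrank ℝ V = n - 1 := by
    have : Fact (Module.finrank ℝ (Euc n) = n - 1 + 1) := ⟨by simp; omega⟩
    exact Submodule.finrank_orthogonal_span_singleton (norm_ne_zero_iff.mp (by simp [hen]))
  rw [← hfin]
  set σ : Euc n → V := fun y => ⟨y - (inner ℝ e y : ℝ) • e, by
    rw [hV, Submodule.mem_orthogonal_singleton_iff_inner_right, inner_sub_right, inner_smul_right,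
      real_inner_self_eq_norm_sq, hen]
    ring⟩ with hσ
  have hproj : ∀ y : Euc n, (σ y : Euc n) = y - (inner ℝ e y : ℝ) • e := fun y => rfl
  have hσc : Continuous σ := by
    refine Continuous.subtype_mk ?_ _
    fun_prop
  have hval : ∀ y : Euc n, inner ℝ y (D y) = (0 : ℝ) →
      α * inner ℝ (σ y : Euc n) (D (σ y)) =
        (inner ℝ e y : ℝ) ^ 2 := by
    intro y hy
    rw [hproj, map_sub, map_smul, hDe]
    simp only [inner_sub_left, inner_sub_right, inner_smul_left, inner_smul_right, inner_neg_right,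
      hy, real_inner_self_eq_norm_sq, hen, ← h.symm e y, hDe, inner_neg_left, real_inner_comm e y,
      conj_trivial]
    field_simp
    ring
  refine finiteAtFilter_of_local_parametrization (σ := σ)
    (Ψ := fun w : V => (w : Euc n) + √(α * inner ℝ (w : Euc n) (D w)) • e) ?_
    hσc.continuousAt ?_
  · have hsub : ContDiff ℝ 1 (fun w : V => (w : Euc n)) := V.subtypeL.contDiff
    refine hsub.contDiffAt.add (ContDiffAt.smul (ContDiffAt.sqrt ?_ ?_) contDiffAt_const)
    · exact contDiffAt_const.mul (hsub.inner ℝ (D.contDiff.comp hsub)).contDiffAt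
    · rw [hval x hq]; positivity
  · have h1 : ∀ᶠ y in nhdsWithin x K, 0 < (inner ℝ e y : ℝ) :=
      ((continuous_const.inner continuous_id).continuousAt.eventually
        (lt_mem_nhds hxe)).filter_mono nhdsWithin_le_nhds
    filter_upwards [h1, self_mem_nhdsWithin] with y hy hyK
    rw [hval y (hKD y hyK).2, Real.sqrt_sq hy.le, hproj]
    simp

/-! ### Stability of the cone -/

lemma continuousOn_schwProfile {n : ℕ} (hn : 2 < n) {m : ℝ} (hm : 0 < m) :
    ContinuousOn (schwProfile n m) (Set.Ioi 0) := fun _ hr =>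
  (hasDerivAt_schwProfile hn hm hr).continuousAt.continuousWithinAt

lemma continuousOn_schwTau {n : ℕ} (hn : 2 < n) {m : ℝ} (hm : 0 < m) :
    ContinuousOn (schwTau n m) (Set.Ioi 0) := fun _ hr =>
  (hasDerivAt_schwTau hn hm hr).continuousAt.continuousWithinAt

/-- The one-dimensional stability inequality along a ray. The positive supersolution behind it is
`(r f(r))⁻³`. -/
lemma ray_stability {n : ℕ} (hn : 8 ≤ n) {m : ℝ} (hm : 0 < m) {ρ a b : ℝ} (hρ : 0 < ρ)
    (ha : a * ρ = horizonRadius n m) (hab : a ≤ b) {φ φ' : ℝ → ℝ}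
    (hφ : ∀ t, HasDerivAt φ (φ' t) t) (hφ' : Continuous φ') (hb : φ b = 0) :
    0 ≤ ∫ t in a..b, schwProfile n m (t * ρ) ^ (n - 3) * t ^ (n - 3) *
      (t * φ' t ^ 2 - ((n : ℝ) - 2) * (3 - schwTau n m (t * ρ) ^ 2) / 2 * φ t ^ 2 / t) := by
  have hn2 : 2 < n := by omega
  -- With `q = n - 3` the condition on the dimension becomes `q ≥ 5`.
  obtain ⟨q, rfl⟩ : ∃ q, n = q + 3 := ⟨n - 3, by omega⟩
  rw [Nat.add_sub_cancel]
  have hq : (5 : ℝ) ≤ q := by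
    have : 5 ≤ q := by omega
    exact_mod_cast this
  have ha0 : 0 < a := by
    have := horizonRadius_pos (q + 3) hm
    rw [← ha] at this
    exact pos_of_mul_pos_left this hρ.le
  have hφc : Continuous φ := continuous_iff_continuousAt.mpr fun t => (hφ t).continuousAt
  set f : ℝ → ℝ := fun t => schwProfile (q + 3) m (t * ρ) with hf
  set τ : ℝ → ℝ := fun t => schwTau (q + 3) m (t * ρ) with hτ
  have hpos : ∀ t ∈ Set.uIcc a b, 0 < t := fun t ht => by
    rw [Set.uIcc_of_le hab] at ht; exact ha0.trans_le ht.1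
  have hmaps : Set.MapsTo (fun t => t * ρ) (Set.uIcc a b) (Set.Ioi 0) := fun t ht =>
    mul_pos (hpos t ht) hρ
  have hfc : ContinuousOn f (Set.uIcc a b) :=
    (continuousOn_schwProfile hn2 hm).comp (by fun_prop) hmaps
  have hτc : ContinuousOn τ (Set.uIcc a b) :=
    (continuousOn_schwTau hn2 hm).comp (by fun_prop) hmaps
  have hinv : ContinuousOn (fun t : ℝ => t⁻¹) (Set.uIcc a b) :=
    continuousOn_inv₀.mono fun t ht => (hpos t ht).ne'
  have hfd : ∀ t ∈ Set.uIcc a b, HasDerivAt f (f t * (τ t - 1) / t) t := by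
    intro t ht
    have h0 := hpos t ht
    have := (hasDerivAt_schwProfile hn2 hm (hmaps ht)).comp t ((hasDerivAt_id t).mul_const ρ)
    refine this.congr_deriv ?_
    simp only [hf, hτ]
    field_simp
  have hτd : ∀ t ∈ Set.uIcc a b, HasDerivAt τ (((q : ℝ) + 1) / 2 * (1 - τ t ^ 2) / t) t := by
    intro t ht
    have h0 := hpos t ht
    have := (hasDerivAt_schwTau hn2 hm (hmaps ht)).comp t ((hasDerivAt_id t).mul_const ρ)
    refine this.congr_deriv ?_
    simp only [hτ]
    push_cast
    field_simp
    ring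
  -- The derivative of `-3 τ (f t)^q φ²`. The function `(r f)⁻³` has logarithmic derivative `-3 τ`
  -- in `log r`, which explains the factor `-3 τ`.
  set g : ℝ → ℝ := fun t => -3 * (f t ^ q * t ^ q) *
    ((((q : ℝ) + 1) / 2 * (1 - τ t ^ 2) + q * τ t ^ 2) * φ t ^ 2 * t⁻¹ + 2 * τ t * φ t * φ' t)
    with hg
  have hGd : ∀ t ∈ Set.uIcc a b,
      HasDerivAt (fun t => -3 * (τ t * (f t * t) ^ q * φ t ^ 2)) (g t) t := by
    intro t ht
    have h0 := hpos t ht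
    have hft : 0 < f t := schwProfile_pos hm (hmaps ht)
    have h1 := (((hτd t ht).fun_mul (((hfd t ht).fun_mul (hasDerivAt_id t)).fun_pow q)).fun_mul
      ((hφ t).fun_pow 2)).const_mul (-3)
    refine h1.congr_deriv ?_
    obtain ⟨s, rfl⟩ : ∃ s, q = s + 1 := ⟨q - 1, by omega⟩
    simp only [hg, id, Nat.add_sub_cancel, mul_pow, pow_succ]
    push_cast
    field_simp
    ring
  have hgc : ContinuousOn g (Set.uIcc a b) := by
    simp only [hg]
    fun_prop
  have hInt := intervalIntegral.integral_eq_sub_of_hasDerivAt hGd hgc.intervalIntegrable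
  have hτa : τ a = 0 := by rw [hτ]; simp only [ha]; exact schwTau_horizonRadius hn2 hm
  have hzero : ∫ t in a..b, g t = 0 := by rw [hInt, hb, hτa]; ring
  rw [← hzero]
  refine intervalIntegral.integral_mono_on hab hgc.intervalIntegrable
    (ContinuousOn.intervalIntegrable ?_) fun t ht => ?_
  · simp only [div_eq_mul_inv _ (_ : ℝ)]
    change ContinuousOn (fun t => f t ^ q * t ^ q * (t * φ' t ^ 2 -
      (((q + 3 : ℕ) : ℝ) - 2) * (3 - τ t ^ 2) * 2⁻¹ * φ t ^ 2 * t⁻¹)) _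
    fun_prop
  · have h0 : 0 < t := ha0.trans_le ht.1
    have hft : 0 < f t := schwProfile_pos hm (mul_pos h0 hρ)
    -- The constant `3` makes the terms free of `τ` in the coefficient of `φ²` cancel, leaving `(2 q
    -- - 1) τ²`. Completing the square with the cross term costs `9 τ²`, and `2 q - 10` remains.
    have hkey : f t ^ q * t ^ q * (t * φ' t ^ 2 - (((q + 3 : ℕ) : ℝ) - 2) * (3 - τ t ^ 2) / 2 *
        φ t ^ 2 / t) - g t = f t ^ q * t ^ q * ((t * φ' t + 3 * τ t * φ t) ^ 2 +
          (2 * q - 10) * (τ t * φ t) ^ 2) / t := by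
      simp only [hg]
      push_cast
      field_simp
      ring
    have : 0 ≤ f t ^ q * t ^ q * ((t * φ' t + 3 * τ t * φ t) ^ 2 +
          (2 * q - 10) * (τ t * φ t) ^ 2) / t := by
      have : 0 ≤ 2 * (q : ℝ) - 10 := by linarith
      positivity
    linarith

/-- The integrand of the second variation, without the part of the gradient that is orthogonal to
the radial direction. -/
noncomputable def radialIndexDensity (n : ℕ) (m : ℝ) (u : Euc n → ℝ) (x : Euc n) : ℝ :=
  schwFactor n m x ^ (n - 3) * (fderiv ℝ u x x ^ 2 / ‖x‖ ^ 2 -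
    ((n : ℝ) - 2) * (3 - schwTau n m ‖x‖ ^ 2) / 2 * u x ^ 2 / ‖x‖ ^ 2)

namespace IsCliffordOp

variable {n : ℕ} {D : Euc n →L[ℝ] Euc n} {α m : ℝ}

/-- Cauchy–Schwarz applied to the tangential gradient and `x`, which is tangent to the cone, so the
projection does not change the radial derivative. -/
lemma radial_le_normSqTanGrad (hm : 0 < m) {x : Euc n} (hx : x ≠ 0)
    (hq : inner ℝ x (D x) = (0 : ℝ)) (u : Euc n → ℝ) :
    (schwFactor n m x ^ 2)⁻¹ * (fderiv ℝ u x x ^ 2 / ‖x‖ ^ 2) ≤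
      normSqTanGrad (schwMetric n m) (coneNormal n m D) u x := by
  have hr := norm_pos_iff.mpr hx
  have hf : 0 < schwFactor n m x := schwProfile_pos hm hr
  have hgrad : metricGradient (schwMetric n m) u x = (schwFactor n m x ^ 2)⁻¹ • gradient u x := by
    rw [metricGradient, ← raiseIndex_schwMetric hm hx]
    congr 1
    ext z
    simp [gradient]
  set P := tanProj (schwMetric n m) (coneNormal n m D) x (metricGradient (schwMetric n m) u x)
    with hP
  have hPx : inner ℝ P x = (schwFactor n m x ^ 2)⁻¹ * fderiv ℝ u x x := by
    have hDx (c : ℝ) : inner ℝ (c • D x) x = (0 : ℝ) := by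
      rw [real_inner_smul_left, real_inner_comm, hq, mul_zero]
    rw [hP, tanProj_cone hm hx, inner_sub_left, hDx, hgrad, inner_smul_left]
    simp [gradient]
  have hcs := real_inner_mul_inner_self_le P x
  rw [hPx] at hcs
  unfold normSqTanGrad
  rw [← hP, schwMetric]
  simp only [real_inner_self_eq_norm_sq] at hcs ⊢
  rw [← mul_div_assoc, div_le_iff₀ (by positivity)]
  calc (schwFactor n m x ^ 2)⁻¹ * fderiv ℝ u x x ^ 2
      = schwFactor n m x ^ 2 * ((schwFactor n m x ^ 2)⁻¹ * fderiv ℝ u x x *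
        ((schwFactor n m x ^ 2)⁻¹ * fderiv ℝ u x x)) := by field_simp
    _ ≤ schwFactor n m x ^ 2 * (‖P‖ ^ 2 * ‖x‖ ^ 2) := by gcongr
    _ = _ := by ring

lemma radialIndexDensity_le (h : IsCliffordOp D α) (hn : 3 ≤ n) (hm : 0 < m) {x : Euc n}
    (hx : x ≠ 0) (hq : inner ℝ x (D x) = (0 : ℝ)) (u : Euc n → ℝ) :
    radialIndexDensity n m u x ≤ (normSqTanGrad (schwMetric n m) (coneNormal n m D) u x
        - (ricciCurvature (schwMetric n m) x (coneNormal n m D x) (coneNormal n m D x)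
          + normSqA (schwMetric n m) (coneNormal n m D) x) * u x ^ 2)
        * schwFactor n m x ^ (n - 1) := by
  have hr := norm_pos_iff.mpr hx
  have hf : 0 < schwFactor n m x := schwProfile_pos hm hr
  have hperp : inner ℝ x (coneNormal n m D x) = (0 : ℝ) := by
    rw [coneNormal, inner_smul_right, hq, mul_zero]
  have hnorm : ‖coneNormal n m D x‖ ^ 2 = (schwFactor n m x ^ 2)⁻¹ := by
    rw [coneNormal, norm_smul, h.norm_map hq, norm_inv, Real.norm_of_nonneg (by positivity)]
    field_simp
  rw [ricciCurvature_schwMetric hn hm hx hperp, h.normSqA_cone hn hm hx hq, hnorm]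
  have hle := radial_le_normSqTanGrad hm hx hq u
  have hpow : schwFactor n m x ^ (n - 1) = schwFactor n m x ^ (n - 3) * schwFactor n m x ^ 2 := by
    rw [← pow_add]; congr 1; omega
  calc radialIndexDensity n m u x = ((schwFactor n m x ^ 2)⁻¹ * (fderiv ℝ u x x ^ 2 / ‖x‖ ^ 2) -
      (((n : ℝ) - 2) / 2 * (1 - schwTau n m ‖x‖ ^ 2) / ‖x‖ ^ 2 * (schwFactor n m x ^ 2)⁻¹ +
        ((n : ℝ) - 2) / (schwFactor n m x * ‖x‖) ^ 2) * u x ^ 2) * schwFactor n m x ^ (n - 1) := by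
        rw [hpow, radialIndexDensity]
        field_simp
        ring
    _ ≤ _ := by gcongr

end IsCliffordOp

lemma measurable_radialIndexDensity {n : ℕ} {m : ℝ} {u : Euc n → ℝ} (hu : ContDiff ℝ ∞ u) :
    Measurable (radialIndexDensity n m u) := by
  have h1 : Measurable fun x => fderiv ℝ u x x :=
    ((hu.continuous_fderiv (by simp)).clm_apply continuous_id).measurable
  have h2 := hu.continuous.measurable
  unfold radialIndexDensity schwFactor schwTau
  fun_prop

lemma continuousOn_radialIndexDensity {n : ℕ} (hn : 2 < n) {m : ℝ} (hm : 0 < m) {u : Euc n → ℝ}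
    (hu : ContDiff ℝ ∞ u) : ContinuousOn (radialIndexDensity n m u) {x | x ≠ 0} := by
  have h1 : Continuous fun x => fderiv ℝ u x x :=
    (hu.continuous_fderiv (by simp)).clm_apply continuous_id
  have h2 := hu.continuous
  have h3 : ContinuousOn (schwFactor n m) {x | x ≠ 0} := fun x hx =>
    (contDiffAt_schwFactor hm hx).continuousAt.continuousWithinAt
  have h4 : ContinuousOn (fun x : Euc n => schwTau n m ‖x‖) {x | x ≠ 0} :=
    (continuousOn_schwTau hn hm).comp continuous_norm.continuousOn fun x hx => norm_pos_iff.mpr hx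
  have h5 : ContinuousOn (fun x : Euc n => (‖x‖ ^ 2)⁻¹) {x | x ≠ 0} :=
    ContinuousOn.inv₀ (by fun_prop) fun x hx => by
      have := norm_pos_iff.mpr hx.out
      positivity
  have : radialIndexDensity n m u = fun x => schwFactor n m x ^ (n - 3) *
      (fderiv ℝ u x x ^ 2 * (‖x‖ ^ 2)⁻¹ -
        ((n : ℝ) - 2) * (3 - schwTau n m ‖x‖ ^ 2) * 2⁻¹ * u x ^ 2 * (‖x‖ ^ 2)⁻¹) := by
    ext x; simp only [radialIndexDensity, div_eq_mul_inv]
  rw [this]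
  exact (h3.pow _).mul (((h1.continuousOn.pow 2).mul h5).sub (ContinuousOn.mul (by fun_prop) h5))

/-- The radial part of the second variation is nonnegative along each ray. -/
lemma ray_integral_radialIndexDensity_nonneg {n : ℕ} (hn : 8 ≤ n) {m : ℝ} (hm : 0 < m) {R : ℝ}
    (hR : horizonRadius n m ≤ R) {u : Euc n → ℝ} (hu : ContDiff ℝ ∞ u) {x : Euc n} (hx : x ≠ 0)
    (hux : u ((R / ‖x‖) • x) = 0) :
    0 ≤ ∫ t in (horizonRadius n m / ‖x‖)..(R / ‖x‖),
      t ^ (n - 2) * radialIndexDensity n m u (t • x) := by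
  have hr := norm_pos_iff.mpr hx
  have hR₀ := horizonRadius_pos n hm
  have hφ : ∀ t : ℝ, HasDerivAt (fun s : ℝ => u (s • x)) (fderiv ℝ u (t • x) x) t := by
    intro t
    have h1 : HasFDerivAt u (fderiv ℝ u (t • x)) (t • x) :=
      (hu.differentiable (by simp) _).hasFDerivAt
    have h2 : HasDerivAt (fun s : ℝ => s • x) x t := by
      simpa using (hasDerivAt_id t).smul_const x
    exact h1.comp_hasDerivAt t h2
  have hφ' : Continuous fun t : ℝ => fderiv ℝ u (t • x) x :=
    ((hu.continuous_fderiv (by simp)).comp (by fun_prop)).clm_apply continuous_const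
  have hab : horizonRadius n m / ‖x‖ ≤ R / ‖x‖ := by gcongr
  have key := ray_stability hn hm hr (div_mul_cancel₀ _ hr.ne') hab hφ hφ' hux
  -- The parameter `t` measures length in units of `‖x‖`, so the density along the ray carries the
  -- constant factor `‖x‖⁻²`.
  have hle : 0 ≤ (‖x‖ ^ 2)⁻¹ * ∫ t in (horizonRadius n m / ‖x‖)..(R / ‖x‖),
      schwProfile n m (t * ‖x‖) ^ (n - 3) * t ^ (n - 3) * (t * fderiv ℝ u (t • x) x ^ 2 -
        ((n : ℝ) - 2) * (3 - schwTau n m (t * ‖x‖) ^ 2) / 2 * u (t • x) ^ 2 / t) := by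
    positivity
  refine hle.trans_eq ?_
  rw [← intervalIntegral.integral_const_mul]
  refine intervalIntegral.integral_congr fun t ht => ?_
  rw [Set.uIcc_of_le hab] at ht
  have ht0 : 0 < t := lt_of_lt_of_le (by positivity) ht.1
  have hnorm : ‖t • x‖ = t * ‖x‖ := by rw [norm_smul, Real.norm_of_nonneg ht0.le]
  have hpow : t ^ (n - 2) = t ^ (n - 3) * t := by rw [← pow_succ]; congr 1; omega
  simp only [radialIndexDensity, schwFactor_eq_profile, hnorm, map_smul, smul_eq_mul, hpow]
  field_simp

namespace IsCliffordOp

variable {n : ℕ} {D : Euc n →L[ℝ] Euc n} {α m : ℝ}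

lemma smul_mem_quadric_iff {t : ℝ} (ht : 0 < t) (x : Euc n) :
    inner ℝ (t • x) (D (t • x)) = (0 : ℝ) ↔ inner ℝ x (D x) = (0 : ℝ) := by
  rw [map_smul, inner_smul_left, inner_smul_right]
  simp [ht.ne']

lemma isCompact_cone_annulus (D : Euc n →L[ℝ] Euc n) (a b : ℝ) :
    IsCompact (quadricCone a D ∩ {x | ‖x‖ ≤ b}) := by
  refine Metric.isCompact_of_isClosed_isBounded
    ((isClosed_quadricCone a D).inter (isClosed_le continuous_norm continuous_const)) ?_
  exact (Metric.isBounded_iff_subset_closedBall 0).mpr ⟨b, fun x hx => by simpa using hx.2⟩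

lemma measure_cone_annulus_lt_top (h : IsCliffordOp D α) (hn : 1 ≤ n) {a : ℝ} (ha : 0 < a)
    (b : ℝ) :
    Measure.euclideanHausdorffMeasure (n - 1) (quadricCone a D ∩ {x | ‖x‖ ≤ b}) < ⊤ :=
  h.measure_lt_top_of_isCompact hn (isCompact_cone_annulus D a b) fun _ hx =>
    ⟨norm_pos_iff.mp (ha.trans_le hx.1.1), hx.1.2⟩

lemma integral_radialIndexDensity_nonneg (h : IsCliffordOp D α) (hn : 8 ≤ n) (hm : 0 < m) {R : ℝ}
    (hR : horizonRadius n m ≤ R) {u : Euc n → ℝ} (hu : ContDiff ℝ ∞ u)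
    (huR : ∀ x ∈ quadricCone (horizonRadius n m) D, ‖x‖ = R → u x = 0) :
    0 ≤ ∫ x in quadricCone (horizonRadius n m) D ∩ {x | ‖x‖ ≤ R}, radialIndexDensity n m u x
      ∂(Measure.euclideanHausdorffMeasure (n - 1)) := by
  have hR₀ := horizonRadius_pos n hm
  set A := quadricCone (horizonRadius n m) D ∩ {x | ‖x‖ ≤ R} with hA
  have hAc : IsCompact A := isCompact_cone_annulus D _ _
  have hA0 : ∀ x ∈ A, x ≠ 0 := fun x hx => norm_pos_iff.mp (hR₀.trans_le hx.1.1)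
  obtain ⟨B, hB⟩ := hAc.exists_bound_of_continuousOn
    ((continuousOn_radialIndexDensity (by omega) hm hu).mono hA0)
  rw [← integral_indicator hAc.measurableSet]
  have hd : n - 1 = n - 2 + 1 := by omega
  have hAfin := h.measure_cone_annulus_lt_top (by omega) hR₀ R
  have hKfin := h.measure_cone_annulus_lt_top (by omega) one_pos 2
  rw [hd] at hAfin hKfin ⊢
  -- The bound `B` may be negative when `A` is empty, hence the maximum with `0`.
  refine integral_nonneg_of_forall_ray (A := A) (K := quadricCone 1 D ∩ {x | ‖x‖ ≤ 2})
    (B := max B 0) (a := horizonRadius n m) (b := R)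
    ((measurable_radialIndexDensity hu).indicator hAc.measurableSet) (fun x => ?_) hR₀
    (isCompact_cone_annulus D 1 2).measurableSet hAfin hKfin
    (fun x hx => Set.indicator_of_notMem hx _) (fun x hx => ⟨hx.1.1, hx.2⟩)
    (fun x t ht hx h1 h2 => ⟨⟨h1, (smul_mem_quadric_iff ht x).mp hx.1.2⟩, h2⟩)
    fun x hx h1 h2 => ?_
  · by_cases hx : x ∈ A
    · rw [Set.indicator_of_mem hx]; exact (hB x hx).trans (le_max_left _ _)
    · rw [Set.indicator_of_notMem hx]; simp
  · have hr : 0 < ‖x‖ := by linarith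
    have hx0 := norm_pos_iff.mp hr
    have hmem : ∀ t : ℝ, 0 < t →
        (t • x ∈ A ↔ t ∈ Set.Icc (horizonRadius n m / ‖x‖) (R / ‖x‖)) := by
      intro t ht
      have hnorm : ‖t • x‖ = t * ‖x‖ := by rw [norm_smul, Real.norm_of_nonneg ht.le]
      rw [Set.mem_Icc, div_le_iff₀ hr, le_div_iff₀ hr, ← hnorm]
      exact ⟨fun h' => ⟨h'.1.1, h'.2⟩,
        fun h' => ⟨⟨h'.1, (smul_mem_quadric_iff ht x).mpr hx.1.2⟩, h'.2⟩⟩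
    -- Since `1 ≤ ‖x‖ ≤ 2`, one fixed parameter interval contains the part of every such ray that
    -- meets the truncated cone.
    have hsub : Set.Icc (horizonRadius n m / ‖x‖) (R / ‖x‖) ⊆
        Set.Icc (horizonRadius n m / 2) R := by
      refine Set.Icc_subset_Icc ?_ ?_
      · gcongr
      · exact div_le_self (hR₀.le.trans hR) h1
    have hux : u ((R / ‖x‖) • x) = 0 := by
      have hRr : 0 < R / ‖x‖ := div_pos (hR₀.trans_le hR) hr
      have hnorm : ‖(R / ‖x‖) • x‖ = R := by
        rw [norm_smul, Real.norm_of_nonneg hRr.le, div_mul_cancel₀ _ hr.ne']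
      exact huR _ ⟨hR.trans_eq hnorm.symm, (smul_mem_quadric_iff hRr x).mpr hx.1.2⟩ hnorm
    have hab : horizonRadius n m / ‖x‖ ≤ R / ‖x‖ := by gcongr
    have hray := ray_integral_radialIndexDensity_nonneg hn hm hR hu hx0 hux
    rw [intervalIntegral.integral_of_le hab, ← integral_Icc_eq_integral_Ioc] at hray
    refine hray.trans_eq ?_
    rw [← Set.inter_eq_self_of_subset_right hsub, ← setIntegral_indicator measurableSet_Icc]
    refine setIntegral_congr_fun measurableSet_Icc fun t ht => ?_
    have ht0 : 0 < t := lt_of_lt_of_le (by positivity) ht.1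
    by_cases hmem' : t • x ∈ A
    · simp only [Set.indicator_of_mem ((hmem t ht0).mp hmem'), Set.indicator_of_mem hmem']
    · simp only [Set.indicator_of_notMem (fun h' => hmem' ((hmem t ht0).mpr h')),
        Set.indicator_of_notMem hmem', mul_zero]

lemma indexForm_cone_nonneg (h : IsCliffordOp D α) (hn : 8 ≤ n) (hm : 0 < m) {R : ℝ}
    (hR : horizonRadius n m ≤ R) {u : Euc n → ℝ} (hu : ContDiff ℝ ∞ u)
    (huR : ∀ x ∈ quadricCone (horizonRadius n m) D, ‖x‖ = R → u x = 0) :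
    0 ≤ indexForm n m (quadricCone (horizonRadius n m) D) (coneNormal n m D) R u := by
  have hR₀ := horizonRadius_pos n hm
  have hAc := isCompact_cone_annulus D (horizonRadius n m) R
  have hA0 : ∀ x ∈ quadricCone (horizonRadius n m) D ∩ {x | ‖x‖ ≤ R}, x ≠ 0 :=
    fun x hx => norm_pos_iff.mp (hR₀.trans_le hx.1.1)
  have hboundary : ∫ x in quadricCone (horizonRadius n m) D ∩ {x | ‖x‖ = horizonRadius n m},
      secondFF (schwMetric n m) (radialNormal n m) x (coneNormal n m D x) (coneNormal n m D x) *
        u x ^ 2 * schwFactor n m x ^ (n - 2) ∂(Measure.euclideanHausdorffMeasure (n - 2)) = 0 := by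
    refine setIntegral_eq_zero_of_forall_eq_zero fun x hx => ?_
    rw [secondFF_radialNormal_horizon (by omega) hm hx.2]
    · ring
    · rw [coneNormal, inner_smul_right, hx.1.2, mul_zero]
  rw [indexForm, hboundary, sub_zero]
  set F : Euc n → ℝ := fun x => (normSqTanGrad (schwMetric n m) (coneNormal n m D) u x
        - (ricciCurvature (schwMetric n m) x (coneNormal n m D x) (coneNormal n m D x)
          + normSqA (schwMetric n m) (coneNormal n m D) x) * u x ^ 2)
        * schwFactor n m x ^ (n - 1) with hF
  -- Comparison with the radial density requires integrability of the full integrand; otherwise its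
  -- Bochner integral is `0` by convention and the bound is trivial.
  by_cases hInt : IntegrableOn F (quadricCone (horizonRadius n m) D ∩ {x | ‖x‖ ≤ R})
      (Measure.euclideanHausdorffMeasure (n - 1))
  · refine (h.integral_radialIndexDensity_nonneg hn hm hR hu huR).trans
      (setIntegral_mono_on ?_ hInt hAc.measurableSet fun x hx =>
        h.radialIndexDensity_le (by omega) hm (hA0 x hx) hx.1.2 u)
    obtain ⟨B, hB⟩ := hAc.exists_bound_of_continuousOn
      ((continuousOn_radialIndexDensity (by omega) hm hu).mono hA0)
    exact Measure.integrableOn_of_bounded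
      (h.measure_cone_annulus_lt_top (by omega) hR₀ R).ne
      (measurable_radialIndexDensity hu).aestronglyMeasurable
      (ae_restrict_of_forall_mem hAc.measurableSet hB)
  · exact (integral_undef hInt).ge

lemma morseIndex_cone (h : IsCliffordOp D α) (hn : 8 ≤ n) (hm : 0 < m) :
    morseIndex n m (quadricCone (horizonRadius n m) D) (coneNormal n m D) = 0 := by
  have hzero : ∀ R, horizonRadius n m ≤ R →
      morseIndexAt n m (quadricCone (horizonRadius n m) D) (coneNormal n m D) R = 0 := by
    intro R hR
    rw [morseIndexAt, ← bot_eq_zero, eq_bot_iff]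
    refine iSup₂_le fun V hV => ?_
    have hVbot : V = ⊥ := by
      refine (Submodule.eq_bot_iff V).mpr fun v hv => ?_
      by_contra hv0
      obtain ⟨u, hu, -, huR, hneg⟩ := hV v hv hv0
      exact hneg.not_ge (h.indexForm_cone_nonneg hn hm hR hu huR)
    subst hVbot
    simp
  have hev : (fun R => morseIndexAt n m (quadricCone (horizonRadius n m) D) (coneNormal n m D) R)
      =ᶠ[Filter.atTop] fun _ => 0 := by
    filter_upwards [Filter.eventually_ge_atTop (horizonRadius n m)] with R hR using hzero R hR
  rw [morseIndex, Filter.limsup_congr hev, Filter.limsup_const]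

end IsCliffordOp

/-! ### The Clifford torus -/

/-- The diagonal operator with entries `α` on the first `k + 1` coordinates and `-α⁻¹` on the
others. -/
noncomputable def cliffordOp (n k : ℕ) (α : ℝ) : Euc n →L[ℝ] Euc n :=
  LinearMap.toContinuousLinearMap
    { toFun := fun x => WithLp.toLp 2 fun i => (if i.val < k + 1 then α else -α⁻¹) * x i
      map_add' := fun x y => by ext i; simp [mul_add]
      map_smul' := fun c x => by ext i; simp [mul_left_comm] }

lemma cliffordOp_apply (n k : ℕ) (α : ℝ) (x : Euc n) (i : Fin n) :
    cliffordOp n k α x i = (if i.val < k + 1 then α else -α⁻¹) * x i := rfl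

/-- The ratio of the radii of the two factors of the Clifford torus. -/
noncomputable def cliffordRatio (n k : ℕ) : ℝ := √(((n : ℝ) - 2 - k) / k)

section Torus

variable {n k : ℕ}

lemma cliffordRatio_pos (hk : 1 ≤ k) (hkn : k + 3 ≤ n) : 0 < cliffordRatio n k := by
  have h1 : (1 : ℝ) ≤ k := by exact_mod_cast hk
  have h2 : (k : ℝ) + 3 ≤ n := by exact_mod_cast hkn
  exact Real.sqrt_pos.mpr (div_pos (by linarith) (by linarith))

lemma cliffordRatio_sq (hk : 1 ≤ k) (hkn : k + 3 ≤ n) :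
    k * cliffordRatio n k ^ 2 = (n : ℝ) - 2 - k := by
  have h1 : (1 : ℝ) ≤ k := by exact_mod_cast hk
  have h2 : (k : ℝ) + 3 ≤ n := by exact_mod_cast hkn
  rw [cliffordRatio, Real.sq_sqrt (div_nonneg (by linarith) (by linarith))]
  field_simp

/-- The trace is `(k + 1) α - (n - k - 1) α⁻¹`. It equals `α - α⁻¹` exactly when `k α² = n - 2 - k`,
which is what fixes the ratio of the radii. -/
lemma isCliffordOp_cliffordOp (hk : 1 ≤ k) (hkn : k + 3 ≤ n) :
    IsCliffordOp (cliffordOp n k (cliffordRatio n k)) (cliffordRatio n k) where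
  pos := cliffordRatio_pos hk hkn
  symm x y := by
    simp only [PiLp.inner_apply, cliffordOp_apply]
    refine Finset.sum_congr rfl fun i _ => ?_
    simp only [RCLike.inner_apply, conj_trivial]
    ring
  sq x := by
    have := cliffordRatio_pos hk hkn
    ext i
    simp only [cliffordOp_apply, PiLp.add_apply, PiLp.smul_apply, smul_eq_mul]
    split_ifs
    · rw [sub_mul, ← mul_assoc, ← mul_assoc, inv_mul_cancel₀ this.ne', one_mul, sub_add_cancel,
        mul_assoc]
    · field_simp
      ring
  trace := by
    have hpos := cliffordRatio_pos hk hkn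
    have hsq := cliffordRatio_sq hk hkn
    set α := cliffordRatio n k
    have h1 : coordTrace (fun v => cliffordOp n k α v) =
        ∑ i : Fin n, (if i.val < k + 1 then α else -α⁻¹) := by
      simp [coordTrace, cliffordOp_apply, stdVec]
    have h2 : ∑ i : Fin n, (if i.val < k + 1 then α else -α⁻¹) =
        ((k : ℝ) + 1) * α - ((n : ℝ) - (k + 1)) * α⁻¹ := by
      obtain ⟨l, rfl⟩ : ∃ l, n = k + 1 + l := ⟨n - (k + 1), by omega⟩
      have hl (i : Fin (k + 1)) :
          (if (Fin.castAdd l i).val < k + 1 then α else -α⁻¹) = α := if_pos i.2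
      have hr (i : Fin l) :
          (if (Fin.natAdd (k + 1) i).val < k + 1 then α else -α⁻¹) = -α⁻¹ :=
        if_neg (by rw [Fin.val_natAdd]; omega)
      rw [Fin.sum_univ_add, Finset.sum_congr rfl fun i _ => hl i,
        Finset.sum_congr rfl fun i _ => hr i]
      simp
      ring
    rw [h1, h2]
    field_simp
    linear_combination hsq

/-- In the squared lengths of the two blocks both descriptions are linear: total length one and `α²
s₁ = s₂` determine the two radii. -/
lemma quadricLink_cliffordOp (hk : 1 ≤ k) (hkn : k + 3 ≤ n) :
    quadricLink (cliffordOp n k (cliffordRatio n k)) = cliffordTorus n k := by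
  have hpos := cliffordRatio_pos hk hkn
  have hsq := cliffordRatio_sq hk hkn
  have h1 : (1 : ℝ) ≤ k := by exact_mod_cast hk
  have h2 : (k : ℝ) + 3 ≤ n := by exact_mod_cast hkn
  set α := cliffordRatio n k
  ext x
  set s₁ := ∑ i : Fin n, (if i.val < k + 1 then x i ^ 2 else 0) with hs₁
  set s₂ := ∑ i : Fin n, (if i.val < k + 1 then 0 else x i ^ 2) with hs₂
  have hnorm : ‖x‖ ^ 2 = s₁ + s₂ := by
    rw [EuclideanSpace.real_norm_sq_eq, hs₁, hs₂, ← Finset.sum_add_distrib]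
    refine Finset.sum_congr rfl fun i _ => ?_
    split_ifs <;> simp
  have hinner : inner ℝ x (cliffordOp n k α x) = α * s₁ - α⁻¹ * s₂ := by
    rw [PiLp.inner_apply, hs₁, hs₂, Finset.mul_sum, Finset.mul_sum, ← Finset.sum_sub_distrib]
    refine Finset.sum_congr rfl fun i _ => ?_
    rw [cliffordOp_apply]
    split_ifs <;> simp <;> ring
  have hN : (n : ℝ) - 2 ≠ 0 := by linarith
  change ‖x‖ = 1 ∧ inner ℝ x (cliffordOp n k α x) = (0 : ℝ) ↔
    s₁ = (k : ℝ) / ((n : ℝ) - 2) ∧ s₂ = ((n : ℝ) - 2 - k) / ((n : ℝ) - 2)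
  rw [hinner, eq_div_iff hN, eq_div_iff hN]
  constructor
  · rintro ⟨hx, hq⟩
    rw [hx] at hnorm
    have hq' : α ^ 2 * s₁ = s₂ := by
      field_simp at hq
      linarith
    have h3 : ((n : ℝ) - 2 - k) * s₁ = k * s₂ := by rw [← hsq, ← hq']; ring
    constructor
    · linear_combination h3 - k * hnorm
    · linear_combination -h3 - ((n : ℝ) - 2 - k) * hnorm
  · rintro ⟨hx₁, hx₂⟩
    have hsum : s₁ + s₂ = 1 := by
      apply mul_right_cancel₀ hN
      linarith
    rw [hsum] at hnorm
    refine ⟨?_, ?_⟩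
    · exact (sq_eq_sq₀ (norm_nonneg x) zero_le_one).mp (by rw [hnorm, one_pow])
    · have : (α ^ 2 * s₁ - s₂) * ((n : ℝ) - 2) = 0 := by
        linear_combination α ^ 2 * hx₁ - hx₂ + hsq
      have h4 := (mul_eq_zero.mp this).resolve_right hN
      field_simp
      linarith

lemma cliffordTorus_nonempty (hk : 1 ≤ k) (hkn : k + 3 ≤ n) : (cliffordTorus n k).Nonempty := by
  have h1 : (1 : ℝ) ≤ k := by exact_mod_cast hk
  have h2 : (k : ℝ) + 3 ≤ n := by exact_mod_cast hkn
  have hN : (0 : ℝ) < (n : ℝ) - 2 := by linarith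
  set i₀ : Fin n := ⟨0, by omega⟩ with hi₀
  set i₁ : Fin n := ⟨k + 1, by omega⟩ with hi₁
  refine ⟨WithLp.toLp 2 fun i => if i = i₀ then √((k : ℝ) / ((n : ℝ) - 2)) else
    if i = i₁ then √(((n : ℝ) - 2 - k) / ((n : ℝ) - 2)) else 0, ?_, ?_⟩
  · rw [Finset.sum_eq_single i₀]
    · simp only [hi₀, if_true]
      rw [if_pos (by omega), Real.sq_sqrt (by positivity)]
    · intro i _ hi
      by_cases hi' : i = i₁
      · simp [hi', hi₁]
      · simp [hi, hi']
    · simp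
  · rw [Finset.sum_eq_single i₁]
    · have h10 : i₁ ≠ i₀ := by simp [hi₀, hi₁]
      simp only [h10, if_false, if_true]
      rw [if_neg (by simp [hi₁]), Real.sq_sqrt (div_nonneg (by linarith) hN.le)]
    · intro i _ hi
      by_cases hi' : i = i₀
      · simp [hi', hi₀]
      · simp [hi, hi']
    · simp

end Torus

theorem mainTheorem4 (n : ℕ) (hn : 8 ≤ n) (m : ℝ) (hm : 0 < m) :
    (∃ (S : Set (Euc n)) (ξ : Euc n → Euc n), IsFreeBoundaryMinimal n m S ξ ∧
      ¬ IsTotallyGeodesic (schwMetric n m) S ξ ∧ morseIndex n m S ξ = 0) ∧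
    ∀ k : ℕ, 1 ≤ k → k + 3 ≤ n →
      (∃ η : Euc n → Euc n, IsClosedMinimalInSphere (cliffordTorus n k) η ∧
        (∀ p ∈ cliffordTorus n k, sphNormSqA η p = (n : ℝ) - 2) ∧
        IsLeast {μ : ℝ | IsJacobiEigenvalue (cliffordTorus n k) η μ} (-((n : ℝ) - 2))) ∧
      ∃ ξ : Euc n → Euc n,
        IsFreeBoundaryMinimal n m (truncatedCone (horizonRadius n m) (cliffordTorus n k)) ξ ∧
        ¬ IsTotallyGeodesic (schwMetric n m)
          (truncatedCone (horizonRadius n m) (cliffordTorus n k)) ξ ∧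
        morseIndex n m (truncatedCone (horizonRadius n m) (cliffordTorus n k)) ξ = 0 := by
  have hR := horizonRadius_pos n hm
  have hcone : ∀ k : ℕ, 1 ≤ k → k + 3 ≤ n → ∃ ξ : Euc n → Euc n,
      IsFreeBoundaryMinimal n m (truncatedCone (horizonRadius n m) (cliffordTorus n k)) ξ ∧
      ¬ IsTotallyGeodesic (schwMetric n m)
        (truncatedCone (horizonRadius n m) (cliffordTorus n k)) ξ ∧
      morseIndex n m (truncatedCone (horizonRadius n m) (cliffordTorus n k)) ξ = 0 := by
    intro k hk hkn
    have h := isCliffordOp_cliffordOp hk hkn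
    have hne := cliffordTorus_nonempty hk hkn
    rw [← quadricLink_cliffordOp hk hkn] at hne ⊢
    rw [truncatedCone_quadricLink hR]
    have hmin := h.isFreeBoundaryMinimal_cone (by omega) hm hne
    exact ⟨_, hmin, h.not_isTotallyGeodesic_cone (by omega) hm hR
      hmin.properly_embedded.nonempty, h.morseIndex_cone hn hm⟩
  refine ⟨?_, fun k hk hkn => ⟨?_, hcone k hk hkn⟩⟩
  -- Any admissible Clifford cone proves the first claim; `k = 1` is the smallest choice.
  · obtain ⟨ξ, hξ⟩ := hcone 1 le_rfl (by omega)
    exact ⟨_, ξ, hξ⟩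
  · have h := isCliffordOp_cliffordOp hk hkn
    have hne := cliffordTorus_nonempty hk hkn
    rw [← quadricLink_cliffordOp hk hkn] at hne ⊢
    exact ⟨_, h.isClosedMinimalInSphere_link hne, fun p hp => h.sphNormSqA_link hp,
      h.isLeast_jacobiEigenvalue hne⟩
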